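/- Let $K=\mathbb C[u_1^{\pm1},\dots,u_n^{\pm1}]$ and let $f\in K$ be a Laurent polynomial on $U=(\mathbb C^*)^n$. Let $\Gamma(f)\subset\mathbb R^n$ be its Newton polyhedron, the convex hull of $0$ and of the exponents of $f$. Assume that $f$ is convenient ($0$ is an interior point of $\Gamma(f)$) and nondegenerate (for every nonempty face $\Delta$ of $\Gamma(f)$ with $0\notin\Delta$, the functions $u_i\,\partial f_\Delta/\partial u_i$, $1\le i\le n$, have no common zero on $U$, where $f_\Delta$ is the part of $f$ with exponents in $\Delta$). Let $\mathcal N_\alpha K$, $\alpha\in\mathbb Q$, be the Newton filtration: $\mathcal N_\alpha K$ is spanned by the monomials $u^a$ with $\phi(a)\le\alpha$, where $\phi$ is the gauge function of $\Gamma(f)$. Let $A_f=K/(\partial f/\partial u_1,\dots,\partial f/\partial u_n)$ be the Jacobi algebra. Let $g_1,\dots,g_r\in\bigcup_{\alpha<1}\mathcal N_\alpha K$, and let $F(u,x)=f(u)+\sum_{i=1}^r x_ig_i(u)$ be the corresponding subdiagram deformation of $f$. It is called injective if $g_1,\dots,g_r$ are linearly independent over $\mathbb C$, and surjective if every element of $A_f$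 is the class of a polynomial in $g_1,\dots,g_r$ with complex coefficients. Let $$G_0=\Omega^n(U)[x,\theta]\,/\,(\theta d_u-d_uF\wedge)\,\Omega^{n-1}(U)[x,\theta]$$ be the Brieskorn lattice of $F$, with the operators $\theta^2\nabla_\theta$, induced by $\eta\,\theta^p\mapsto F\eta\,\theta^p+p\,\eta\,\theta^{p+1}$, and $\theta\nabla_{\partial_{x_j}}$, induced by $\eta\,\theta^p\mapsto \partial_{x_j}(\eta)\,\theta^{p+1}-g_j\,\eta\,\theta^p$ (for $\eta\in\Omega^n(U)[x]$). Let $E=G_0/\theta G_0$, let $R_0$ and $\Phi_{\partial_{x_j}}$ be the endomorphisms of $E$ that these operators induce, and let $\omega$ be the class of $\frac{du_1}{u_1}\wedge\cdots\wedge\frac{du_n}{u_n}$ in $E$. Let $E^o=E/(x_1,\dots,x_r)E$, let $R_0^o$, $\omega^o$ be induced by $R_0$, $\omega$, and for $\xi=\sum_j\xi_j\partial_{x_j}$ with $\xi_j\in\mathbb C$ let $\Phi^o_\xi$ be the endomorphism of $E^o$ induced by $\sum_j\xi_j\Phi_{\partial_{x_j}}$. 1) If $F$ is injective, then $\omega^o$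 satisfies (IC): the map $\xi\mapsto-\Phi^o_\xi(\omega^o)$ from $\mathbb C^r$ to $E^o$ is injective. Moreover, the classes of $g_1,\dots,g_r$ in $A_f$ are linearly independent over $\mathbb C$. 2) If $F$ is surjective, then $\omega^o$ satisfies (GC): $\omega^o$ and its images under iteration of the maps $R_0^o$ and $\Phi^o_\xi$ (for all $\xi\in\mathbb C^r$) generate the complex vector space $E^o$. -/

import Mathlib

noncomputable section

namespace SubdiagramDeformation

open MvPolynomial

/-! ### Laurent polynomials -/

/-- Laurent polynomials in `u_1, …, u_n` with coefficients in `R`: the monomial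
`u_1^{a_1} ⋯ u_n^{a_n}` is `AddMonoidAlgebra.single a 1`. -/
abbrev Laurent (R : Type) [CommRing R] (n : ℕ) : Type := AddMonoidAlgebra R (Fin n → ℤ)

section Derivations

variable {R : Type} [CommRing R] {n : ℕ}

/-- The `R`-linear map `u^a ↦ a_i u^a`, that is `u_i ∂/∂u_i`. -/
def eulerLin (R : Type) [CommRing R] {n : ℕ} (i : Fin n) : Laurent R n →ₗ[R] Laurent R n :=
  (Finsupp.lsum R fun a : Fin n → ℤ => ((a i : ℤ) : R) • AddMonoidAlgebra.lsingle a) ∘ₗ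
    (AddMonoidAlgebra.coeffLinearEquiv R).toLinearMap

theorem eulerLin_single (i : Fin n) (a : Fin n → ℤ) (c : R) :
    eulerLin R i (AddMonoidAlgebra.single a c) = AddMonoidAlgebra.single a ((a i : R) * c) := by
  simp [eulerLin]

theorem eulerLin_mul (i : Fin n) (p q : Laurent R n) :
    eulerLin R i (p * q) = p * eulerLin R i q + q * eulerLin R i p := by
  induction p using AddMonoidAlgebra.induction_linear with
  | zero => simp
  | add p p' hp hp' => simp only [add_mul, map_add, hp, hp', mul_add]; ring
  | single a c =>
    induction q using AddMonoidAlgebra.induction_linear with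
    | zero => simp
    | add q q' hq hq' => simp only [add_mul, map_add, hq, hq', mul_add]; ring
    | single b d =>
      rw [mul_comm (AddMonoidAlgebra.single b d)]
      simp only [AddMonoidAlgebra.single_mul_single, eulerLin_single, ← AddMonoidAlgebra.single_add,
        Pi.add_apply, Int.cast_add]
      congr 1
      ring

/-- The derivation `u_i ∂/∂u_i` of the ring of Laurent polynomials with coefficients in `R`. -/
def euler (R : Type) [CommRing R] {n : ℕ} (i : Fin n) :
    Derivation R (Laurent R n) (Laurent R n) :=
  Derivation.mk' (eulerLin R i) (eulerLin_mul i)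

theorem euler_single (i : Fin n) (a : Fin n → ℤ) (c : R) :
    euler R i (AddMonoidAlgebra.single a c) = AddMonoidAlgebra.single a ((a i : R) * c) :=
  eulerLin_single i a c

/-- The partial derivative `∂f/∂u_i = u_i⁻¹ · u_i ∂f/∂u_i`. -/
def partialDeriv (i : Fin n) (f : Laurent R n) : Laurent R n :=
  AddMonoidAlgebra.single (-Pi.single i 1) 1 * euler R i f

variable [Algebra ℂ R]

/-- A `ℂ`-linear derivation `D` of the ring `R` applied to each coefficient, as a linear map. -/
def onCoeffLin (D : Derivation ℂ R R) : Laurent R n →ₗ[ℂ] Laurent R n :=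
  (AddMonoidAlgebra.coeffLinearEquiv ℂ).symm.toLinearMap ∘ₗ
    Finsupp.mapRange.linearMap D.toLinearMap ∘ₗ
      (AddMonoidAlgebra.coeffLinearEquiv ℂ).toLinearMap

theorem onCoeffLin_single (D : Derivation ℂ R R) (a : Fin n → ℤ) (c : R) :
    onCoeffLin D (AddMonoidAlgebra.single a c) = AddMonoidAlgebra.single a (D c) := by
  ext b
  simp [onCoeffLin]

theorem onCoeffLin_mul (D : Derivation ℂ R R) (p q : Laurent R n) :
    onCoeffLin D (p * q) = p * onCoeffLin D q + q * onCoeffLin D p := by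
  induction p using AddMonoidAlgebra.induction_linear with
  | zero => simp
  | add p p' hp hp' => simp only [add_mul, map_add, hp, hp', mul_add]; ring
  | single a c =>
    induction q using AddMonoidAlgebra.induction_linear with
    | zero => simp
    | add q q' hq hq' => simp only [add_mul, map_add, hq, hq', mul_add]; ring
    | single b d =>
      rw [mul_comm (AddMonoidAlgebra.single b d)]
      simp only [AddMonoidAlgebra.single_mul_single, onCoeffLin_single,
        ← AddMonoidAlgebra.single_add, Derivation.leibniz, smul_eq_mul]
      congr 1
      ring

/-- A `ℂ`-linear derivation of the coefficient ring, extended to Laurent polynomials by acting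
on each coefficient (so that it kills the variables `u_i`). -/
def onCoeff (D : Derivation ℂ R R) : Derivation ℂ (Laurent R n) (Laurent R n) :=
  Derivation.mk' (onCoeffLin D) (onCoeffLin_mul D)

theorem onCoeff_single (D : Derivation ℂ R R) (a : Fin n → ℤ) (c : R) :
    onCoeff D (AddMonoidAlgebra.single a c) = AddMonoidAlgebra.single a (D c) :=
  onCoeffLin_single D a c

theorem onCoeff_euler (D : Derivation ℂ R R) (i : Fin n) (p : Laurent R n) :
    onCoeff D (euler R i p) = euler R i (onCoeff D p) := by
  induction p using AddMonoidAlgebra.induction_linear with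
  | zero => simp
  | add p p' hp hp' => simp only [map_add, hp, hp']
  | single a c =>
    simp only [euler_single, onCoeff_single, Derivation.leibniz, smul_eq_mul]
    simp

theorem onCoeff_smul (D : Derivation ℂ R R) (s : R) (p : Laurent R n) :
    onCoeff D (s • p) = s • onCoeff D p + D s • p := by
  induction p using AddMonoidAlgebra.induction_linear with
  | zero => simp
  | add p p' hp hp' => simp only [smul_add, map_add, hp, hp']; abel
  | single a c =>
    simp only [AddMonoidAlgebra.smul_single, onCoeff_single, Derivation.leibniz, smul_eq_mul,
      ← AddMonoidAlgebra.single_add]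
    congr 1
    ring

end Derivations

/-! ### Newton polyhedron, Newton filtration, Jacobi algebra -/

section Newton

variable {n : ℕ}

/-- An exponent `a ∈ ℤⁿ`, as a point of `ℝⁿ`. -/
def expPt (a : Fin n → ℤ) : Fin n → ℝ := fun i => (a i : ℝ)

/-- The Newton polyhedron of `f`: the convex hull of `0` and of the exponents of `f`. -/
def newtonPolyhedron (f : Laurent ℂ n) : Set (Fin n → ℝ) :=
  convexHull ℝ (insert 0 (expPt '' (f.coeff.support : Set (Fin n → ℤ))))

/-- `f` is convenient if the origin is an interior point of its Newton polyhedron. -/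
def IsConvenient (f : Laurent ℂ n) : Prop :=
  (0 : Fin n → ℝ) ∈ interior (newtonPolyhedron f)

open Classical in
/-- The part `f_Δ` of `f` whose exponents belong to `Δ`. -/
def facePart (f : Laurent ℂ n) (Δ : Set (Fin n → ℝ)) : Laurent ℂ n :=
  AddMonoidAlgebra.ofCoeff (f.coeff.filter fun a => expPt a ∈ Δ)

/-- The value of a Laurent polynomial at a point of the torus `U = (ℂ*)ⁿ`. -/
def evalTorus (z : Fin n → ℂˣ) (f : Laurent ℂ n) : ℂ :=
  f.coeff.sum fun a c => c * ∏ i, ((z i ^ a i : ℂˣ) : ℂ)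

/-- `f` is nondegenerate with respect to its Newton polyhedron: for every (nonempty) face `Δ` of
the polyhedron that does not contain the origin, the functions `u_i ∂f_Δ/∂u_i`, `i = 1, …, n`,
have no common zero on the torus. (All faces of a polytope are exposed.) -/
def IsNondegenerate (f : Laurent ℂ n) : Prop :=
  ∀ Δ : Set (Fin n → ℝ), IsExposed ℝ (newtonPolyhedron f) Δ → Δ.Nonempty → (0 : Fin n → ℝ) ∉ Δ →
    ¬ ∃ z : Fin n → ℂˣ, ∀ i, evalTorus z (euler ℂ i (facePart f Δ)) = 0

/-- The Newton filtration `𝒩_α K` of `f`: it is spanned by the monomials `u^a` whose Newton degree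
is at most `α`. The Newton degree of `u^a` is the value at `a` of the function which is linear on
the cone over each facet of the Newton polyhedron and equal to `1` on these facets, that is the
gauge (Minkowski functional) of the polyhedron. -/
def newtonFiltration (f : Laurent ℂ n) (α : ℚ) : Submodule ℂ (Laurent ℂ n) :=
  Submodule.span ℂ {p | ∃ a : Fin n → ℤ,
    gauge (newtonPolyhedron f) (expPt a) ≤ (α : ℝ) ∧ p = AddMonoidAlgebra.single a 1}

/-- `g` is subdiagram (with respect to `f`): it belongs to `𝒩_{<1} K = ⋃_{α < 1} 𝒩_α K`. -/
def IsSubdiagram (f g : Laurent ℂ n) : Prop :=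
  ∃ α : ℚ, α < 1 ∧ g ∈ newtonFiltration f α

/-- The Jacobian ideal `(∂f/∂u_1, …, ∂f/∂u_n)`. -/
def jacobiIdeal (f : Laurent ℂ n) : Ideal (Laurent ℂ n) :=
  Ideal.span (Set.range fun i => partialDeriv i f)

/-- The Jacobi algebra `A_f = K / (∂f/∂u_1, …, ∂f/∂u_n)`. -/
abbrev JacobiAlgebra (f : Laurent ℂ n) : Type := Laurent ℂ n ⧸ jacobiIdeal f

/-- The class of a Laurent polynomial in `A_f`. -/
abbrev jacobiClass (f : Laurent ℂ n) : Laurent ℂ n →+* JacobiAlgebra f :=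
  Ideal.Quotient.mk (jacobiIdeal f)

variable {r : ℕ}

/-- The deformation `F = f + ∑ x_i g_i` is injective: the `g_i` are linearly independent. -/
def IsInjectiveDeformation (g : Fin r → Laurent ℂ n) : Prop :=
  LinearIndependent ℂ g

/-- The deformation `F = f + ∑ x_i g_i` is surjective: every element of `A_f` is the class of a
polynomial in `g_1, …, g_r` with complex coefficients. -/
def IsSurjectiveDeformation (f : Laurent ℂ n) (g : Fin r → Laurent ℂ n) : Prop :=
  ∀ y : JacobiAlgebra f, ∃ p : MvPolynomial (Fin r) ℂ, jacobiClass f (aeval g p) = y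

end Newton

/-! ### The Brieskorn lattice of a deformation and its connection -/

section Brieskorn

variable {n r : ℕ}

/-- The ring `ℂ[x, θ]`, `x = (x_1, …, x_r)`: the variable `none` is `θ`, the variable `some j`
is `x_j`. -/
abbrev Params (r : ℕ) : Type := MvPolynomial (Option (Fin r)) ℂ

/-- The variable `θ`. -/
def theta (r : ℕ) : Params r := X none

/-- Laurent polynomials in `u` with complex coefficients, inside `ℂ[x, θ][u, u⁻¹]`. -/
def constLaurent (r : ℕ) (p : Laurent ℂ n) : Laurent (Params r) n :=
  AddMonoidAlgebra.mapRingHom (Fin n → ℤ) (algebraMap ℂ (Params r)) p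

theorem onCoeff_constLaurent (D : Derivation ℂ (Params r) (Params r)) (p : Laurent ℂ n) :
    onCoeff D (constLaurent r p) = 0 := by
  unfold constLaurent
  induction p using AddMonoidAlgebra.induction_linear with
  | zero => simp
  | add p p' hp hp' => simp only [map_add, hp, hp', add_zero]
  | single a c => simp [onCoeff_single]

/-- The deformation `F(u, x) = f(u) + ∑ x_i g_i(u)`. -/
def deformation (f : Laurent ℂ n) (g : Fin r → Laurent ℂ n) : Laurent (Params r) n :=
  constLaurent r f + ∑ j, (X (some j) : Params r) • constLaurent r (g j)

theorem onCoeff_theta_deformation (f : Laurent ℂ n) (g : Fin r → Laurent ℂ n) :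
    onCoeff (pderiv none) (deformation f g) = 0 := by
  simp [deformation, onCoeff_smul, onCoeff_constLaurent]

theorem onCoeff_x_deformation (f : Laurent ℂ n) (g : Fin r → Laurent ℂ n) (j : Fin r) :
    onCoeff (pderiv (some j)) (deformation f g) = constLaurent r (g j) := by
  simp [deformation, onCoeff_smul, onCoeff_constLaurent, pderiv_X, Pi.single_apply]

/-- The map `θ d_u - d_u F ∧ : Ω^{n-1}(U)[x, θ] → Ω^n(U)[x, θ]`.

`Ω^n(U)` is free over `K = ℂ[u, u⁻¹]` on `du/u = du_1/u_1 ∧ ⋯ ∧ du_n/u_n`, and `h du/u` is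
represented by `h`. `Ω^{n-1}(U)` is free on the contractions of `du/u` with the invariant vector
fields `u_i ∂/∂u_i`, `i = 1, …, n` (these are, up to sign, the products of the `du_k/u_k`,
`k ≠ i`), and the family `(b_i)` represents the form `η` with coordinates `b_i` in this basis;
then `dη = (∑ u_i ∂b_i/∂u_i) du/u` and `dF ∧ η = (∑ b_i u_i ∂F/∂u_i) du/u`. -/
def twistedDifferential (f : Laurent ℂ n) (g : Fin r → Laurent ℂ n) :
    (Fin n → Laurent (Params r) n) →ₗ[Params r] Laurent (Params r) n :=
  ∑ i, (theta r • (euler (Params r) i : Laurent (Params r) n →ₗ[Params r] _) -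
    LinearMap.mulRight (Params r) (euler (Params r) i (deformation f g))) ∘ₗ LinearMap.proj i

theorem twistedDifferential_apply (f : Laurent ℂ n) (g : Fin r → Laurent ℂ n)
    (b : Fin n → Laurent (Params r) n) :
    twistedDifferential f g b =
      ∑ i, (theta r • euler (Params r) i (b i) - b i * euler (Params r) i (deformation f g)) := by
  simp [twistedDifferential]

/-- The Brieskorn lattice `G_0 = Ω^n(U)[x, θ] / (θ d_u - d_u F ∧) Ω^{n-1}(U)[x, θ]` of the
deformation `F = f + ∑ x_i g_i`, as a `ℂ[x, θ]`-module. -/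
abbrev Brieskorn (f : Laurent ℂ n) (g : Fin r → Laurent ℂ n) : Type :=
  Laurent (Params r) n ⧸ LinearMap.range (twistedDifferential f g)

/-- The operator `θ² ∇_θ` of the Gauss-Manin connection, on `Ω^n(U)[x, θ]`: it sends `ω θ^p` to `F ω θ^p + p ω θ^{p+1}`. -/
def formTheta (f : Laurent ℂ n) (g : Fin r → Laurent ℂ n) :
    Laurent (Params r) n →ₗ[ℂ] Laurent (Params r) n where
  toFun h := deformation f g * h + theta r ^ 2 • onCoeff (pderiv none) h
  map_add' h h' := by simp only [mul_add, map_add, smul_add]; abel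
  map_smul' c h := by
    simp only [mul_smul_comm, Derivation.map_smul, smul_add, RingHom.id_apply, smul_comm c]

/-- The operator `θ ∇_{∂_{x_j}}` of the Gauss-Manin connection, on `Ω^n(U)[x, θ]`: it sends `ω θ^p` to
`∂_{x_j}(ω) θ^{p+1} - (∂F/∂x_j) ω θ^p`. -/
def formX (g : Fin r → Laurent ℂ n) (j : Fin r) :
    Laurent (Params r) n →ₗ[ℂ] Laurent (Params r) n where
  toFun h := theta r • onCoeff (pderiv (some j)) h - constLaurent r (g j) * h
  map_add' h h' := by simp only [mul_add, map_add, smul_add]; abel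
  map_smul' c h := by
    simp only [mul_smul_comm, Derivation.map_smul, smul_sub, RingHom.id_apply, smul_comm c]

theorem formTheta_apply (f : Laurent ℂ n) (g : Fin r → Laurent ℂ n) (h : Laurent (Params r) n) :
    formTheta f g h = deformation f g * h + theta r ^ 2 • onCoeff (pderiv none) h := rfl

theorem formX_apply (g : Fin r → Laurent ℂ n) (j : Fin r) (h : Laurent (Params r) n) :
    formX g j h = theta r • onCoeff (pderiv (some j)) h - constLaurent r (g j) * h := rfl

theorem formTheta_smul (f : Laurent ℂ n) (g : Fin r → Laurent ℂ n) (s : Params r)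
    (h : Laurent (Params r) n) :
    formTheta f g (s • h) = s • formTheta f g h + theta r • (theta r * pderiv none s) • h := by
  simp only [formTheta_apply, onCoeff_smul, mul_smul_comm]
  module

theorem formX_smul (g : Fin r → Laurent ℂ n) (j : Fin r) (s : Params r)
    (h : Laurent (Params r) n) :
    formX g j (s • h) = s • formX g j h + theta r • pderiv (some j) s • h := by
  simp only [formX_apply, onCoeff_smul, mul_smul_comm]
  module

theorem formTheta_mem (f : Laurent ℂ n) (g : Fin r → Laurent ℂ n) (h : Laurent (Params r) n)
    (hh : h ∈ LinearMap.range (twistedDifferential f g)) :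
    formTheta f g h ∈ LinearMap.range (twistedDifferential f g) := by
  obtain ⟨b, rfl⟩ := hh
  refine ⟨(fun i => formTheta f g (b i)) + theta r • b, ?_⟩
  rw [map_add, map_smul, formTheta_apply]
  simp only [twistedDifferential_apply, formTheta_apply, map_sum, map_sub, onCoeff_smul,
    Derivation.leibniz, smul_eq_mul, Finset.mul_sum, Finset.smul_sum, ← Finset.sum_add_distrib]
  refine Finset.sum_congr rfl fun i _ => ?_
  have h1 : pderiv none (theta r) = 1 := by simp [theta]
  have h2 : onCoeff (pderiv none) (euler (Params r) i (deformation f g)) = 0 := by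
    rw [onCoeff_euler, onCoeff_theta_deformation, map_zero]
  simp only [h1, h2, map_add, Derivation.map_smul, Derivation.leibniz, onCoeff_euler, smul_eq_mul, mul_sub,
    add_mul, smul_mul_assoc, mul_smul_comm]
  simp only [mul_comm (deformation f g), mul_right_comm _ (deformation f g), mul_zero]
  rw [mul_comm (euler (Params r) i (deformation f g)) (onCoeff _ _)]
  module

theorem formX_mem (f : Laurent ℂ n) (g : Fin r → Laurent ℂ n) (j : Fin r)
    (h : Laurent (Params r) n) (hh : h ∈ LinearMap.range (twistedDifferential f g)) :
    formX g j h ∈ LinearMap.range (twistedDifferential f g) := by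
  obtain ⟨b, rfl⟩ := hh
  refine ⟨fun i => formX g j (b i), ?_⟩
  rw [formX_apply]
  simp only [twistedDifferential_apply, formX_apply, map_sum, map_sub, onCoeff_smul,
    Derivation.leibniz, smul_eq_mul, Finset.mul_sum, Finset.smul_sum, ← Finset.sum_sub_distrib]
  refine Finset.sum_congr rfl fun i _ => ?_
  have h1 : pderiv (some j) (theta r) = 0 := by simp [theta, pderiv_X]
  have h2 : onCoeff (pderiv (some j)) (euler (Params r) i (deformation f g)) =
      euler (Params r) i (constLaurent r (g j)) := by
    rw [onCoeff_euler, onCoeff_x_deformation]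
  simp only [h1, h2, Derivation.map_smul, onCoeff_euler, mul_sub,
    sub_mul, smul_mul_assoc, mul_smul_comm, zero_smul, add_zero]
  rw [mul_comm (euler (Params r) i (deformation f g)) (onCoeff _ _),
    mul_assoc (constLaurent r (g j))]
  module

/-- The map induced on a quotient by a `ℂ`-linear map that preserves the submodule. -/
def descend {M : Type} [AddCommGroup M] [Module (Params r) M] [Module ℂ M]
    [IsScalarTower ℂ (Params r) M] (N : Submodule (Params r) M) (T : M →ₗ[ℂ] M)
    (hT : ∀ m ∈ N, T m ∈ N) : (M ⧸ N) →ₗ[ℂ] (M ⧸ N) :=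
  (Submodule.Quotient.restrictScalarsEquiv ℂ N).toLinearMap ∘ₗ
    (N.restrictScalars ℂ).mapQ (N.restrictScalars ℂ) T hT ∘ₗ
      (Submodule.Quotient.restrictScalarsEquiv ℂ N).symm.toLinearMap

theorem descend_mk {M : Type} [AddCommGroup M] [Module (Params r) M] [Module ℂ M]
    [IsScalarTower ℂ (Params r) M] (N : Submodule (Params r) M) (T : M →ₗ[ℂ] M)
    (hT : ∀ m ∈ N, T m ∈ N) (m : M) :
    descend N T hT (Submodule.Quotient.mk m) = Submodule.Quotient.mk (T m) := rfl

/-- `θ² ∇_θ` on the Brieskorn lattice `G_0`. -/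
def nablaTheta (f : Laurent ℂ n) (g : Fin r → Laurent ℂ n) :
    Brieskorn f g →ₗ[ℂ] Brieskorn f g :=
  descend _ (formTheta f g) (formTheta_mem f g)

/-- `θ ∇_{∂_{x_j}}` on the Brieskorn lattice `G_0`. -/
def nablaX (f : Laurent ℂ n) (g : Fin r → Laurent ℂ n) (j : Fin r) :
    Brieskorn f g →ₗ[ℂ] Brieskorn f g :=
  descend _ (formX g j) (formX_mem f g j)

theorem nablaTheta_smul (f : Laurent ℂ n) (g : Fin r → Laurent ℂ n) (s : Params r)
    (m : Brieskorn f g) :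
    ∃ m', nablaTheta f g (s • m) = s • nablaTheta f g m + theta r • m' := by
  obtain ⟨h, rfl⟩ := Submodule.Quotient.mk_surjective _ m
  refine ⟨Submodule.Quotient.mk ((theta r * pderiv none s) • h), ?_⟩
  rw [← Submodule.Quotient.mk_smul]
  unfold nablaTheta
  rw [descend_mk, descend_mk, formTheta_smul]
  rfl

theorem nablaX_smul (f : Laurent ℂ n) (g : Fin r → Laurent ℂ n) (j : Fin r) (s : Params r)
    (m : Brieskorn f g) :
    ∃ m', nablaX f g j (s • m) = s • nablaX f g j m + theta r • m' := by
  obtain ⟨h, rfl⟩ := Submodule.Quotient.mk_surjective _ m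
  refine ⟨Submodule.Quotient.mk (pderiv (some j) s • h), ?_⟩
  rw [← Submodule.Quotient.mk_smul]
  unfold nablaX
  rw [descend_mk, descend_mk, formX_smul]
  rfl

end Brieskorn

/-! ### The bundle `E`, the endomorphism `R_0` and the Higgs field `Φ` -/

section Higgs

variable {n r : ℕ}

/-- `M / θ M`. -/
abbrev ModTheta (r : ℕ) (M : Type) [AddCommGroup M] [Module (Params r) M] : Type :=
  M ⧸ (Ideal.span {theta r} • ⊤ : Submodule (Params r) M)

theorem mk_theta_smul {M : Type} [AddCommGroup M] [Module (Params r) M] (m : M) :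
    (Submodule.Quotient.mk (theta r • m) : ModTheta r M) = 0 :=
  (Submodule.Quotient.mk_eq_zero _).2
    (Submodule.smul_mem_smul (Ideal.mem_span_singleton_self _) trivial)

/-- An additive map `T` of `M` which is linear over `ℂ[x, θ]` modulo `θ` induces a linear
endomorphism of `M / θ M`. -/
def symbol {M : Type} [AddCommGroup M] [Module (Params r) M] [Module ℂ M] (T : M →ₗ[ℂ] M)
    (hT : ∀ (s : Params r) (m : M), ∃ m', T (s • m) = s • T m + theta r • m') :
    ModTheta r M →ₗ[Params r] ModTheta r M :=
  Submodule.liftQ _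
    { toFun := fun m => Submodule.Quotient.mk (T m)
      map_add' := fun m m' => by rw [map_add, Submodule.Quotient.mk_add]
      map_smul' := fun s m => by
        obtain ⟨m', hm'⟩ := hT s m
        rw [hm', Submodule.Quotient.mk_add, mk_theta_smul, add_zero, Submodule.Quotient.mk_smul]
        rfl }
    (by
      intro y hy
      rw [Submodule.ideal_span_singleton_smul] at hy
      obtain ⟨m, -, rfl⟩ := hy
      obtain ⟨m', hm'⟩ := hT (theta r) m
      change (Submodule.Quotient.mk (T (theta r • m)) : ModTheta r M) = 0
      rw [hm', Submodule.Quotient.mk_add, mk_theta_smul, mk_theta_smul, add_zero])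

theorem symbol_mk {M : Type} [AddCommGroup M] [Module (Params r) M] [Module ℂ M] (T : M →ₗ[ℂ] M)
    (hT : ∀ (s : Params r) (m : M), ∃ m', T (s • m) = s • T m + theta r • m') (m : M) :
    symbol T hT (Submodule.Quotient.mk m) = Submodule.Quotient.mk (T m) := rfl

/-- `E = G_0 / θ G_0`, a module over `ℂ[x] = ℂ[x, θ] / (θ)`, written as a `ℂ[x, θ]`-module on
which `θ` acts by zero. -/
abbrev HiggsBundle (f : Laurent ℂ n) (g : Fin r → Laurent ℂ n) : Type :=
  ModTheta r (Brieskorn f g)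

/-- The endomorphism `R_0` of `E` induced by `θ² ∇_θ`. -/
def R0 (f : Laurent ℂ n) (g : Fin r → Laurent ℂ n) :
    HiggsBundle f g →ₗ[Params r] HiggsBundle f g :=
  symbol (nablaTheta f g) (nablaTheta_smul f g)

/-- The component `Φ^{(j)} = Φ_{∂_{x_j}}` of the Higgs field, the endomorphism of `E` induced by
`θ ∇_{∂_{x_j}}`. -/
def Higgs (f : Laurent ℂ n) (g : Fin r → Laurent ℂ n) (j : Fin r) :
    HiggsBundle f g →ₗ[Params r] HiggsBundle f g :=
  symbol (nablaX f g j) (nablaX_smul f g j)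

/-- The section `ω` of `E`, the class of the volume form `du/u`. -/
def omega (f : Laurent ℂ n) (g : Fin r → Laurent ℂ n) : HiggsBundle f g :=
  Submodule.Quotient.mk (Submodule.Quotient.mk (1 : Laurent (Params r) n))

/-- The ideal `(x_1, …, x_r)` of the origin. -/
def originIdeal (r : ℕ) : Ideal (Params r) :=
  Ideal.span (Set.range fun j : Fin r => X (some j))

/-- The fibre `E^o = E / (x) E` at the origin. -/
abbrev FibreE (f : Laurent ℂ n) (g : Fin r → Laurent ℂ n) : Type :=
  HiggsBundle f g ⧸ (originIdeal r • ⊤ : Submodule (Params r) (HiggsBundle f g))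

/-- The endomorphism of the fibre `E^o` induced by an endomorphism of `E`. -/
def fibreMap {f : Laurent ℂ n} {g : Fin r → Laurent ℂ n}
    (T : HiggsBundle f g →ₗ[Params r] HiggsBundle f g) : Module.End ℂ (FibreE f g) :=
  (Submodule.mapQ (originIdeal r • ⊤ : Submodule (Params r) (HiggsBundle f g))
    (originIdeal r • ⊤) T (by
      rw [← Submodule.map_le_iff_le_comap, Submodule.map_smul'']
      exact Submodule.smul_mono le_rfl le_top)).restrictScalars ℂ

/-- The endomorphism `R_0^o` of `E^o`. -/
def R0Fibre (f : Laurent ℂ n) (g : Fin r → Laurent ℂ n) : Module.End ℂ (FibreE f g) :=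
  fibreMap (R0 f g)

/-- `Φ^o_ξ` for a tangent vector `ξ = ∑ ξ_j ∂_{x_j}` at the origin. -/
def HiggsFibre (f : Laurent ℂ n) (g : Fin r → Laurent ℂ n) (ξ : Fin r → ℂ) :
    Module.End ℂ (FibreE f g) :=
  ∑ j, ξ j • fibreMap (Higgs f g j)

/-- The value `ω^o` of `ω` in `E^o`. -/
def omegaFibre (f : Laurent ℂ n) (g : Fin r → Laurent ℂ n) : FibreE f g :=
  Submodule.Quotient.mk (omega f g)

/-- Condition (IC) for `ω^o`: the period map `ξ ↦ -Φ^o_ξ(ω^o)` is injective on the tangent space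
at the origin. -/
def SatisfiesIC (f : Laurent ℂ n) (g : Fin r → Laurent ℂ n) : Prop :=
  Function.Injective fun ξ : Fin r → ℂ => -HiggsFibre f g ξ (omegaFibre f g)

/-- Condition (GC) for `ω^o`: the images of `ω^o` under all finite compositions of the maps
`R_0^o` and `Φ^o_ξ` (`ω^o` itself included) span `E^o`. -/
def SatisfiesGC (f : Laurent ℂ n) (g : Fin r → Laurent ℂ n) : Prop :=
  Submodule.span ℂ ((fun T : Module.End ℂ (FibreE f g) => T (omegaFibre f g)) ''
    (Submonoid.closure (insert (R0Fibre f g) (Set.range (HiggsFibre f g))) :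
      Set (Module.End ℂ (FibreE f g)))) = ⊤

end Higgs

end SubdiagramDeformation

end

/-!
The fibre `E^o` is the quotient of `K = ℂ[u, u⁻¹]` by the ideal `J` generated by
`y_i = u_i ∂f/∂u_i`, with `ω^o` the class of `1` and `-Φ^o_ξ` the multiplication by `∑ ξ_j g_j`
(`mem_of_fibreClass_eq_zero`, `fibreClass_eq_zero_of_mem`, `fibreMap_Higgs_fibreClass`). Hence (GC)
restates surjectivity, and (IC) and the independence of the classes of the `g_j` both follow from
the fact that `J` contains no nonzero `h` of Newton degree less than `1`
(`eq_zero_of_mem_span_euler`).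

This fact is proved without the Cohen–Macaulay property of the associated graded ring. The input is
a statement on valuations `v` of the fraction field of `K` that are trivial on `ℂ`: if `v (u^a) > 1`
for some exponent `a` of `f`, then the largest `v (u^a)` is equal to the largest `v (y_i)`
(`exists_le_valuation_euler`). The exponents `a` where `v (u^a)` is largest form a face `Δ` avoiding
`0`, and by the Nullstellensatz nondegeneracy says that the `u_i ∂f_Δ/∂u_i` generate the unit ideal.
By the valuative criterion of integrality, `K` is then finite over `P = ℂ[y_1, …, y_n]`, the `y_i`
are algebraically independent, and `h` satisfies an equation `h^(d+1) = ∑_{i ≤ d} p_i(y) h^i` with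
`deg p_i ≤ d - i`.

Let `l : K → P` be `P`-linear with `l 1 ≠ 0`. By the equation, `l (h^j)` has degree at most
`j d / (d + 1) + O(1)`. If `h ∈ J`, it also vanishes to order at least `j` at the origin, so
`l (h^j) = 0` for all large `j`, and this forces `h = 0` (`eq_zero_of_pow_eq_aeval`).
-/

noncomputable section

namespace SubdiagramDeformation

open MvPolynomial

/-! ### Order and degree over a polynomial ring -/

/-- A nonzero linear functional on the fraction field of `K` over that of `P`, multiplied by a
common denominator of its values on generators of `K`. -/
theorem exists_linearMap_one_ne_zero (P K : Type) [CommRing P] [IsDomain P] [CommRing K]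
    [IsDomain K] [Algebra P K] [Module.Finite P K] [FaithfulSMul P K] :
    ∃ l : K →ₗ[P] P, l 1 ≠ 0 := by
  let F := FractionRing P
  let L := FractionRing K
  let _ : Algebra F L := FractionRing.liftAlgebra P L
  obtain ⟨μ, hμ⟩ : ∃ μ : Module.Dual F L, μ 1 ≠ 0 := by
    by_contra! h
    exact one_ne_zero ((Module.forall_dual_apply_eq_zero_iff F (1 : L)).1 h)
  let μK : K →ₗ[P] F := (μ.restrictScalars P) ∘ₗ (IsScalarTower.toAlgHom P K L).toLinearMap
  obtain ⟨s, hs⟩ := (Module.Finite.fg_top : (⊤ : Submodule P K).FG)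
  obtain ⟨b, hb⟩ := IsLocalization.exist_integer_multiples (nonZeroDivisors P) s
    (fun x => μK x)
  have hall : ∀ x : K, ((b : P) • μK) x ∈ LinearMap.range (Algebra.linearMap P F) := by
    intro x
    have hx : x ∈ Submodule.span P (s : Set K) := hs ▸ Submodule.mem_top
    induction hx using Submodule.span_induction with
    | mem x hx =>
      obtain ⟨c, hc⟩ := hb x hx
      exact ⟨c, hc⟩
    | zero => simp
    | add x y _ _ hx hy => rw [map_add]; exact add_mem hx hy
    | smul c x _ hx => rw [map_smul]; exact Submodule.smul_mem _ c hx
  have hinj : Function.Injective (Algebra.linearMap P F) := IsFractionRing.injective P F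
  let e := LinearEquiv.ofInjective (Algebra.linearMap P F) hinj
  refine ⟨e.symm.toLinearMap ∘ₗ LinearMap.codRestrict _ ((b : P) • μK) hall, fun h => ?_⟩
  rw [LinearMap.comp_apply, LinearEquiv.coe_coe, LinearEquiv.map_eq_zero_iff,
    ← Subtype.coe_inj, LinearMap.codRestrict_apply] at h
  have h1 : μK 1 = μ 1 := by simp [μK]
  rw [LinearMap.smul_apply, h1] at h
  rcases smul_eq_zero.1 h with h | h
  · exact nonZeroDivisors.ne_zero b.2 h
  · exact hμ h

theorem linearMap_mem_of_mem_map {P K : Type} [CommRing P] [CommRing K] [Algebra P K]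
    (l : K →ₗ[P] P) (I : Ideal P) {x : K} (hx : x ∈ I.map (algebraMap P K)) : l x ∈ I := by
  have hx' : x ∈ (I • ⊤ : Submodule P K) := by
    rw [Ideal.smul_top_eq_map]; exact hx
  refine Submodule.smul_induction_on hx' (fun a ha y _ => ?_) fun x y hx hy => ?_
  · rw [map_smul]; exact I.mul_mem_right _ ha
  · rw [map_add]; exact I.add_mem hx hy

/-- A sequence of polynomials with a linear recurrence whose coefficient on the term
`d + 1 - i` steps back has degree at most `d - i` grows in degree with slope at most `d / (d + 1)`. -/
theorem totalDegree_bound {σ k : Type} [CommRing k] {d : ℕ} (a : ℕ → MvPolynomial σ k)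
    (p : ℕ → MvPolynomial σ k) (hp : ∀ i ≤ d, (p i).totalDegree + i ≤ d)
    (ha : ∀ j, a (j + (d + 1)) = ∑ i ∈ Finset.range (d + 1), p i * a (j + i)) :
    ∃ C, ∀ j, (d + 1) * (a j).totalDegree ≤ C + d * j := by
  refine ⟨∑ i ∈ Finset.range (d + 1), (d + 1) * (a i).totalDegree, fun j => ?_⟩
  induction j using Nat.strong_induction_on with
  | _ j ih =>
    rcases lt_or_ge j (d + 1) with hj | hj
    · exact (Finset.single_le_sum (f := fun i => (d + 1) * (a i).totalDegree)
        (fun _ _ => Nat.zero_le _) (Finset.mem_range.2 hj)).trans (Nat.le_add_right _ _)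
    · obtain ⟨j, rfl⟩ := Nat.exists_eq_add_of_le' hj
      obtain ⟨i, hi, hle⟩ : ∃ i ∈ Finset.range (d + 1),
          (a (j + (d + 1))).totalDegree ≤ (p i * a (j + i)).totalDegree := by
        rw [ha]
        obtain ⟨i, hi, h⟩ := Finset.exists_mem_eq_sup (Finset.range (d + 1)) ⟨0, by simp⟩
          (fun i => (p i * a (j + i)).totalDegree)
        exact ⟨i, hi, h ▸ totalDegree_finsetSum _ _⟩
      have hi' : i ≤ d := Nat.lt_succ_iff.1 (Finset.mem_range.1 hi)
      have h1 := hp i hi'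
      have h2 := ih (j + i) (by omega)
      have h3 := totalDegree_mul (p i) (a (j + i))
      set C := ∑ i ∈ Finset.range (d + 1), (d + 1) * (a i).totalDegree
      obtain ⟨e, rfl⟩ := Nat.exists_eq_add_of_le' hi'
      nlinarith

theorem eq_zero_of_totalDegree_lt {σ k : Type} [CommRing k] {j : ℕ} {p : MvPolynomial σ k}
    (hp : p ∈ idealOfVars σ k ^ j) (hd : p.totalDegree < j) : p = 0 := by
  ext m
  rw [mem_pow_idealOfVars_iff] at hp
  by_contra hm
  have hm' : m ∈ p.support := by simpa [mem_support_iff] using hm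
  have h1 := le_totalDegree hm'
  have h2 := hp m hm'
  rw [Finsupp.sum] at h1
  rw [Finsupp.degree_apply] at h2
  omega

/-- The order-versus-degree argument. For a linear functional `l` on `K` over the polynomial ring `P`,
`l (h ^ j)` vanishes to order `j` at the origin because `h` lies in the ideal of the variables,
while the relation forces its degree to grow with slope `d / (d + 1) < 1`. So `l (h ^ j) = 0` for
large `j`, which is incompatible with `l 1 ≠ 0` and an algebraic equation of `h` over `P` with
nonzero constant term. -/
theorem eq_zero_of_pow_eq_aeval {σ k K : Type} [Field k] [CommRing K] [IsDomain K] [Algebra k K]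
    [Algebra (MvPolynomial σ k) K] [IsScalarTower k (MvPolynomial σ k) K]
    [Module.Finite (MvPolynomial σ k) K] [FaithfulSMul (MvPolynomial σ k) K] {h : K}
    (hh : h ∈ (idealOfVars σ k).map (algebraMap (MvPolynomial σ k) K)) {d : ℕ}
    (G : MvPolynomial (Option σ) k) (hG : G.totalDegree ≤ d)
    (hrel : h ^ (d + 1) =
      aeval (fun i => i.elim h fun s => algebraMap (MvPolynomial σ k) K (X s)) G) : h = 0 := by
  obtain ⟨l, hl⟩ := exists_linearMap_one_ne_zero (MvPolynomial σ k) K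
  let p : ℕ → MvPolynomial σ k := (optionEquivLeft k σ G).coeff
  have hp : ∀ i, p i ≠ 0 → (p i).totalDegree + i ≤ d := fun i hi =>
    (totalDegree_coeff_optionEquivLeft_add_le k σ G i
      ((Polynomial.le_natDegree_of_ne_zero hi).trans
        ((natDegree_optionEquivLeft k G).trans_le (degreeOf_le_totalDegree _ _)))).trans hG
  have hrel' : h ^ (d + 1) = ∑ i ∈ Finset.range (d + 1), p i • h ^ i := by
    have hcomp : ((Polynomial.aeval h : Polynomial (MvPolynomial σ k) →ₐ[MvPolynomial σ k] K
        ).restrictScalars k).comp (optionEquivLeft k σ).toAlgHom =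
        aeval (fun i => i.elim h fun s => algebraMap (MvPolynomial σ k) K (X s)) := by
      refine algHom_ext fun i => ?_
      cases i with
      | none => simp [optionEquivLeft_X_none]
      | some s => simp [optionEquivLeft_X_some]
    rw [hrel, ← hcomp]
    refine Polynomial.aeval_eq_sum_range' (Nat.lt_succ_of_le ?_) h
    rw [Polynomial.natDegree_le_iff_coeff_eq_zero]
    intro i hi
    by_contra h0
    have := hp i h0
    omega
  have ha : ∀ j, l (h ^ (j + (d + 1))) = ∑ i ∈ Finset.range (d + 1), p i * l (h ^ (j + i)) := by
    intro j
    rw [pow_add, hrel', Finset.mul_sum, map_sum]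
    refine Finset.sum_congr rfl fun i _ => ?_
    rw [mul_smul_comm, map_smul, ← pow_add, smul_eq_mul]
  obtain ⟨C, hC⟩ := totalDegree_bound (fun j => l (h ^ j)) p (fun i hi => by
    by_cases h0 : p i = 0
    · simpa [h0] using hi
    · exact hp i h0) ha
  have hvan : ∀ j, C < j → l (h ^ j) = 0 := by
    intro j hj
    refine eq_zero_of_totalDegree_lt (j := j) (linearMap_mem_of_mem_map l _ ?_) ?_
    · rw [Ideal.map_pow]; exact Ideal.pow_mem_pow hh j
    -- `(d + 1) j ≤ (d + 1) deg ≤ C + d j` would give `j ≤ C`.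
    · have := hC j
      nlinarith
  by_contra hne
  obtain ⟨q, hq0, hq⟩ := IsAlgebraic.exists_nonzero_coeff_and_aeval_eq_zero
    (Algebra.IsIntegral.isIntegral (R := MvPolynomial σ k) h).isAlgebraic
    (mem_nonZeroDivisors_of_ne_zero hne)
  classical
  -- At the last `j` with `l (h ^ j) ≠ 0`, applying `l` to `h ^ j * q(h) = 0` isolates `q.coeff 0`.
  obtain ⟨j, hj, hmax⟩ : ∃ j, l (h ^ j) ≠ 0 ∧ ∀ i, j < i → l (h ^ i) = 0 := by
    have hle : ∀ j, l (h ^ j) ≠ 0 → j ≤ C := fun j hj => not_lt.1 fun h => hj (hvan j h)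
    refine ⟨Nat.findGreatest (fun j => l (h ^ j) ≠ 0) C,
      Nat.findGreatest_spec (P := fun j => l (h ^ j) ≠ 0) (Nat.zero_le C) (by simpa using hl),
      fun i hi => ?_⟩
    by_contra hne
    exact Nat.findGreatest_is_greatest hi (hle i hne) hne
  have h0 : l (h ^ j * Polynomial.aeval h q) = q.coeff 0 * l (h ^ j) := by
    rw [Polynomial.aeval_eq_sum_range, Finset.mul_sum, map_sum, Finset.sum_range_succ']
    rw [Finset.sum_eq_zero]
    · simp
    · intro i _
      rw [mul_smul_comm, map_smul, ← pow_add, hmax _ (by omega), smul_zero]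
  rw [hq, mul_zero, map_zero] at h0
  exact mul_ne_zero hq0 hj h0.symm

/-! ### Convexity and integral relations -/

/-- Finitely many real numbers admit a `ℚ`-linear functional that keeps the positive ones positive and
takes integer values: perturb the values of a `ℚ`-basis of their span to rational numbers, then clear
denominators. -/
theorem exists_rat_linear_pos (s : Finset ℝ) :
    ∃ φ : ℝ →ₗ[ℚ] ℚ, ∀ x ∈ s, (0 < x → 0 < φ x) ∧ ∃ z : ℤ, φ x = z := by
  let W : Submodule ℚ ℝ := Submodule.span ℚ s
  let b := Module.finBasis ℚ W
  let m := Module.finrank ℚ W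
  have hW : ∀ x ∈ s, x ∈ W := fun x hx => Submodule.subset_span hx
  let U : Set (Fin m → ℝ) := {r | ∀ x : s, 0 < (x : ℝ) →
    0 < ∑ j, (b.repr ⟨x, hW x x.2⟩ j : ℝ) * r j}
  have hU : IsOpen U := by
    have : U = ⋂ x : s, {r | 0 < (x : ℝ) → 0 < ∑ j, (b.repr ⟨x, hW x x.2⟩ j : ℝ) * r j} := by
      ext r; simp [U]
    rw [this]
    refine isOpen_iInter_of_finite fun x => ?_
    by_cases hx : 0 < (x : ℝ)
    · simp only [hx, forall_const]
      exact isOpen_lt continuous_const (by fun_prop)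
    · simp [hx]
  have hne : (fun j => (b j : ℝ)) ∈ U := by
    intro x hx
    have h := congrArg (Subtype.val) (b.sum_repr ⟨x, hW x x.2⟩)
    simp only [AddSubmonoidClass.coe_finsetSum, SetLike.val_smul, Rat.smul_def] at h
    rwa [h]
  have hd : DenseRange (fun (q : Fin m → ℚ) (j : Fin m) => (q j : ℝ)) :=
    DenseRange.piMap fun _ => Rat.denseRange_cast
  obtain ⟨q, hq⟩ := hd.exists_mem_open hU ⟨_, hne⟩
  obtain ⟨φ, hφ⟩ := LinearMap.exists_extend (b.constr ℚ q)
  have hφ' : ∀ x (hx : x ∈ s), φ x = ∑ j, b.repr ⟨x, hW x hx⟩ j * q j := by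
    intro x hx
    have := LinearMap.congr_fun hφ ⟨x, hW x hx⟩
    rw [Module.Basis.constr_apply_fintype] at this
    simpa using this
  obtain ⟨N, hN⟩ := IsLocalization.exist_integer_multiples (nonZeroDivisors ℤ) s (fun x => φ x)
  have hN0 : ((N : ℤ) : ℚ) ≠ 0 := by exact_mod_cast nonZeroDivisors.ne_zero N.2
  -- The denominator `N` may be negative; its square is positive and still clears denominators.
  refine ⟨((N : ℤ) : ℚ) ^ 2 • φ, fun x hx => ⟨fun hx0 => ?_, ?_⟩⟩
  · have h1 := hq ⟨x, hx⟩ hx0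
    have h2 : 0 < φ x := by
      rw [hφ' x hx]
      dsimp only at h1
      exact_mod_cast h1
    rw [LinearMap.smul_apply, smul_eq_mul]
    positivity
  · obtain ⟨z, hz⟩ := hN x hx
    refine ⟨N * z, ?_⟩
    simp only [algebraMap_int_eq, eq_intCast, zsmul_eq_mul] at hz
    rw [LinearMap.smul_apply, smul_eq_mul]
    push_cast
    rw [hz]; ring

/-- A real linear relation between integer vectors can be replaced by an integral one with the same
signs. -/
theorem exists_int_relation {n : ℕ} {ι : Type} (T : Finset ι) (p : ι → Fin n → ℤ) (w : ι → ℝ)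
    (b : Fin n → ℤ) (t : ℝ) (hb : t • expPt b = ∑ a ∈ T, w a • expPt (p a)) :
    ∃ (N : ℤ) (z : ι → ℤ), N • b = ∑ a ∈ T, z a • p a ∧ (0 < t → 0 < N) ∧
      (∑ a ∈ T, w a < t → ∑ a ∈ T, z a < N) ∧
      ∀ a ∈ T, (0 < w a → 0 < z a) ∧ (w a = 0 → z a = 0) := by
  classical
  obtain ⟨φ, hφ⟩ := exists_rat_linear_pos (insert t (insert (t - ∑ a ∈ T, w a) (T.image w)))
  have hw : ∀ a ∈ T, (0 < w a → 0 < φ (w a)) ∧ ∃ z : ℤ, φ (w a) = z := fun a ha =>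
    hφ _ (by simp only [Finset.mem_insert, Finset.mem_image]; exact Or.inr (Or.inr ⟨a, ha, rfl⟩))
  choose! z hz using fun a ha => (hw a ha).2
  obtain ⟨ht, N, hN⟩ := hφ t (by simp)
  have hc : ∀ (x : ℝ) (k : ℤ), φ (x * k) = φ x * k := by
    intro x k
    rw [mul_comm, ← zsmul_eq_mul, map_zsmul, zsmul_eq_mul, mul_comm]
  refine ⟨N, z, ?_, fun h => ?_, fun h => ?_, fun a ha => ⟨fun h => ?_, fun h => ?_⟩⟩
  · ext i
    have h := congrArg φ (congrFun hb i)
    simp only [Pi.smul_apply, expPt, Finset.sum_apply, smul_eq_mul, map_sum, hc, hN] at h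
    rw [Finset.sum_congr rfl fun a ha => by rw [hz a ha]] at h
    simp only [Pi.smul_apply, Finset.sum_apply, smul_eq_mul]
    exact_mod_cast h
  · have := ht h
    rw [hN] at this
    exact_mod_cast this
  · have := (hφ (t - ∑ a ∈ T, w a) (by simp)).1 (sub_pos.2 h)
    rw [map_sub, map_sum, hN, Finset.sum_congr rfl hz] at this
    have h' : (0 : ℚ) < ((N - ∑ a ∈ T, z a : ℤ) : ℚ) := by push_cast; exact this
    exact sub_pos.1 (by exact_mod_cast h')
  · have := (hw a ha).1 h
    rw [hz a ha] at this
    exact_mod_cast this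
  · have := hz a ha
    rw [h, map_zero] at this
    exact_mod_cast this.symm

/-- Points of a convex hull as combinations of a fixed finite family, with a convex condition `I` on
the sum of the weights: `I = {1}` describes a convex hull, `I = (-∞, 1]` a convex hull with `0`. -/
theorem exists_weights_of_mem_convexHull {E : Type} [AddCommGroup E] [Module ℝ E] {ι : Type}
    (p : ι → E) (T : Finset ι) (I : Set ℝ) (hI : Convex ℝ I) (s : Set E)
    (hs : ∀ x ∈ s, ∃ w : ι → ℝ, (∀ a, 0 ≤ w a) ∧ ∑ a ∈ T, w a ∈ I ∧ ∑ a ∈ T, w a • p a = x)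
    {x : E} (hx : x ∈ convexHull ℝ s) :
    ∃ w : ι → ℝ, (∀ a, 0 ≤ w a) ∧ ∑ a ∈ T, w a ∈ I ∧ ∑ a ∈ T, w a • p a = x := by
  refine convexHull_min (t := {x | ∃ w : ι → ℝ, (∀ a, 0 ≤ w a) ∧ ∑ a ∈ T, w a ∈ I ∧
    ∑ a ∈ T, w a • p a = x}) hs ?_ hx
  rintro _ ⟨w, hw, hwI, rfl⟩ _ ⟨w', hw', hwI', rfl⟩ α β hα hβ hαβ
  refine ⟨α • w + β • w', fun a => ?_, ?_, ?_⟩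
  · have := hw a
    have := hw' a
    simp only [Pi.add_apply, Pi.smul_apply, smul_eq_mul]
    positivity
  · have := hI hwI hwI' hα hβ hαβ
    simpa [Finset.sum_add_distrib, Finset.mul_sum] using this
  · simp [add_smul, Finset.sum_add_distrib, Finset.smul_sum, mul_smul]

/-- A form of Motzkin's transposition theorem: if no nontrivial relation between the vectors
`p a - p m` has nonnegative coefficients off `S`, then some linear functional is constant on `S` and
strictly smaller on the other points of `A`. It separates the span of `p a - p m`, `a ∈ S`, from the
convex hull of the remaining vectors. -/
theorem exists_functional_eq_lt {E : Type} [NormedAddCommGroup E] [NormedSpace ℝ E]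
    [FiniteDimensional ℝ E] {ι : Type} [DecidableEq ι] (p : ι → E) (A S : Finset ι)
    (m : ι)
    (hrel : ∀ w : ι → ℝ, (∀ a ∈ A \ S, 0 ≤ w a) → ∑ a ∈ A ∪ S, w a • (p a - p m) = 0 →
      ∀ a ∈ A \ S, w a = 0) :
    ∃ l : E →L[ℝ] ℝ, (∀ a ∈ S, l (p a) = l (p m)) ∧ ∀ a ∈ A \ S, l (p a) < l (p m) := by
  let q : ι → E := fun a => p a - p m
  let W : Submodule ℝ E := Submodule.span ℝ (q '' S)
  let C : Set E := convexHull ℝ (q '' (A \ S : Finset ι))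
  have hdisj : Disjoint C (W : Set E) := by
    rw [Set.disjoint_left]
    intro x hxC hxW
    obtain ⟨e, he⟩ := (Submodule.mem_span_image_finset_iff_exists_fun' ℝ).1 hxW
    obtain ⟨w, hw0, hw1, hwx⟩ : ∃ w : ι → ℝ, (∀ a ∈ A \ S, 0 ≤ w a) ∧
        ∑ a ∈ A \ S, w a = 1 ∧ ∑ a ∈ A \ S, w a • q a = x := by
      obtain ⟨w, hw0, hw1, hwx⟩ := exists_weights_of_mem_convexHull q (A \ S) {1}
        (convex_singleton 1) _ (by
          rintro _ ⟨a, ha, rfl⟩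
          refine ⟨Pi.single a 1, fun b => ?_, ?_, ?_⟩
          · by_cases h : b = a
            · subst h; simp
            · simp [h]
          · simpa [Finset.sum_pi_single] using ha
          · rw [Finset.sum_eq_single_of_mem a (by exact_mod_cast ha)
              fun b _ hb => by simp [hb]]
            simp) hxC
      exact ⟨w, fun a _ => hw0 a, hw1, hwx⟩
    have h := hrel (fun a => if a ∈ S then - e a else w a)
      (fun a ha => by simpa [(Finset.mem_sdiff.1 ha).2] using hw0 a ha) (by
        rw [← Finset.sdiff_union_self_eq_union, Finset.sum_union Finset.sdiff_disjoint]
        rw [Finset.sum_congr rfl fun a ha => by rw [if_neg (Finset.mem_sdiff.1 ha).2], hwx,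
          Finset.sum_congr rfl fun a ha => by rw [if_pos ha], ← he]
        simp [q])
    have : ∑ a ∈ A \ S, w a = 0 := Finset.sum_eq_zero fun a ha => by
      simpa [(Finset.mem_sdiff.1 ha).2] using h a ha
    linarith
  obtain ⟨l, u, v, hl1, huv, hl2⟩ := geometric_hahn_banach_compact_closed
    (convex_convexHull ℝ _) (((Finset.finite_toSet (A \ S)).image q).isCompact_convexHull ℝ)
    W.convex W.closed_of_finiteDimensional hdisj
  have hv : v < 0 := by simpa using hl2 0 W.zero_mem
  -- A functional bounded below on a subspace vanishes there.
  have hW : ∀ x ∈ W, l x = 0 := by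
    intro x hx
    by_contra h0
    have := hl2 ((v / l x) • x) (W.smul_mem _ hx)
    rw [map_smul, smul_eq_mul, div_mul_cancel₀ _ h0] at this
    exact lt_irrefl _ this
  refine ⟨l, fun a ha => ?_, fun a ha => ?_⟩
  · have := hW (q a) (Submodule.subset_span ⟨a, ha, rfl⟩)
    rw [map_sub] at this
    linarith
  · have := hl1 (q a) (subset_convexHull ℝ _ ⟨a, by exact_mod_cast ha, rfl⟩)
    rw [map_sub] at this
    linarith

/-! ### Weights and faces of the Newton polyhedron -/

/-- The exponents of `f` of maximal weight, for a weight `ℓ` with values in any ordered abelian group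
and positive maximum, are the exponents in an exposed face of the Newton polyhedron that avoids `0`. -/
theorem exists_exposed_face {n : ℕ} {Λ : Type} [AddCommGroup Λ] [LinearOrder Λ]
    [IsOrderedAddMonoid Λ] (f : Laurent ℂ n) (ℓ : (Fin n → ℤ) →+ Λ) (m : Fin n → ℤ)
    (hm : m ∈ f.coeff.support) (hpos : 0 < ℓ m) (hmax : ∀ a ∈ f.coeff.support, ℓ a ≤ ℓ m) :
    ∃ Δ : Set (Fin n → ℝ), IsExposed ℝ (newtonPolyhedron f) Δ ∧ Δ.Nonempty ∧
      (0 : Fin n → ℝ) ∉ Δ ∧ ∀ a ∈ f.coeff.support, expPt a ∈ Δ ↔ ℓ a = ℓ m := by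
  classical
  let A : Finset (Fin n → ℤ) := insert 0 f.coeff.support
  let S : Finset (Fin n → ℤ) := f.coeff.support.filter fun a => ℓ a = ℓ m
  have hlt : ∀ a ∈ A \ S, ℓ a < ℓ m := by
    intro a ha
    obtain ⟨haA, haS⟩ := Finset.mem_sdiff.1 ha
    rcases Finset.mem_insert.1 haA with rfl | haf
    · rwa [map_zero]
    · exact lt_of_le_of_ne (hmax a haf) fun h => haS (Finset.mem_filter.2 ⟨haf, h⟩)
  obtain ⟨l, hlS, hlA⟩ := exists_functional_eq_lt expPt A S m (by
    intro w hw hsum a₀ ha₀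
    by_contra hne
    obtain ⟨N, z, hz, -, -, hzw⟩ := exists_int_relation (A ∪ S) (fun a => a - m) w 0 0 (by
      rw [zero_smul, ← hsum]
      refine Finset.sum_congr rfl fun a _ => ?_
      congr 1
      ext i
      simp [expPt])
    rw [smul_zero] at hz
    have h := congrArg ℓ hz
    rw [map_zero, map_sum] at h
    refine (Finset.sum_neg' (s := A ∪ S) (f := fun a => ℓ (z a • (a - m))) ?_
      ⟨a₀, Finset.mem_union_left _ (Finset.mem_sdiff.1 ha₀).1, ?_⟩).ne' h
    · intro a ha
      rw [map_zsmul, map_sub]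
      by_cases haS : a ∈ S
      · rw [(Finset.mem_filter.1 haS).2, sub_self, smul_zero]
      · have haAS : a ∈ A \ S :=
          Finset.mem_sdiff.2 ⟨(Finset.mem_union.1 ha).resolve_right haS, haS⟩
        have hz0 : 0 ≤ z a := by
          rcases (hw a haAS).lt_or_eq with h | h
          · exact ((hzw a ha).1 h).le
          · exact ((hzw a ha).2 h.symm).ge
        have := zsmul_nonneg (sub_pos.2 (hlt a haAS)).le hz0
        rw [← neg_sub, smul_neg]
        exact neg_nonpos.2 this
    · rw [map_zsmul, map_sub, ← neg_sub, smul_neg]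
      refine neg_neg_of_pos (zsmul_pos (sub_pos.2 (hlt a₀ ha₀)) ?_)
      exact (hzw a₀ (Finset.mem_union_left _ (Finset.mem_sdiff.1 ha₀).1)).1
        (lt_of_le_of_ne (hw a₀ ha₀) (Ne.symm hne)))
  have h0A : (0 : Fin n → ℤ) ∈ A \ S := by
    refine Finset.mem_sdiff.2 ⟨Finset.mem_insert_self _ _, fun h => ?_⟩
    have := (Finset.mem_filter.1 h).2
    rw [map_zero] at this
    exact hpos.ne this
  have hexp0 : expPt (0 : Fin n → ℤ) = 0 := by ext i; simp [expPt]
  have hl0 : 0 < l (expPt m) := by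
    have := hlA 0 h0A
    rwa [hexp0, map_zero] at this
  have hle : ∀ x ∈ newtonPolyhedron f, l x ≤ l (expPt m) := by
    intro x hx
    refine convexHull_min (t := {x | l x ≤ l (expPt m)}) ?_
      (convex_halfSpace_le l.toLinearMap.isLinear _) hx
    rintro _ (rfl | ⟨a, ha, rfl⟩)
    · simpa using hl0.le
    · by_cases haS : a ∈ S
      · exact (hlS a haS).le
      · exact (hlA a (Finset.mem_sdiff.2 ⟨Finset.mem_insert_of_mem ha, haS⟩)).le
  have hmem : ∀ a ∈ f.coeff.support, expPt a ∈ newtonPolyhedron f := fun a ha =>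
    subset_convexHull ℝ _ (Set.mem_insert_of_mem _ ⟨a, ha, rfl⟩)
  have h0mem : (0 : Fin n → ℝ) ∈ newtonPolyhedron f :=
    subset_convexHull ℝ _ (Set.mem_insert _ _)
  refine ⟨{x ∈ newtonPolyhedron f | ∀ y ∈ newtonPolyhedron f, l y ≤ l x}, fun _ => ⟨l, rfl⟩,
    ⟨expPt m, hmem m hm, hle⟩, fun h => ?_, fun a ha => ⟨fun h => ?_, fun h => ⟨hmem a ha, ?_⟩⟩⟩
  · have := h.2 _ (hmem m hm)
    rw [map_zero] at this
    exact absurd this (not_le.2 hl0)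
  · by_contra hne
    have haS : a ∉ S := fun h => hne (Finset.mem_filter.1 h).2
    exact absurd (h.2 _ (hmem m hm))
      (not_le.2 (hlA a (Finset.mem_sdiff.2 ⟨Finset.mem_insert_of_mem ha, haS⟩)))
  · rw [hlS a (Finset.mem_filter.2 ⟨ha, h⟩)]
    exact hle

/-- If `b` has Newton degree below `t`, some positive multiple `N • b` is a combination of exponents of
`f` with natural coefficients, of sum less than `N` if `t ≤ 1`. -/
theorem exists_int_combination_of_gauge_lt {n : ℕ} {f : Laurent ℂ n} (hconv : IsConvenient f)
    (b : Fin n → ℤ) {t : ℝ} (ht : gauge (newtonPolyhedron f) (expPt b) < t) :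
    ∃ (N : ℤ) (z : (Fin n → ℤ) → ℤ), 0 < N ∧ (∀ a ∈ f.coeff.support, 0 ≤ z a) ∧
      N • b = ∑ a ∈ f.coeff.support, z a • a ∧
      (t ≤ 1 → ∑ a ∈ f.coeff.support, z a < N) := by
  have habs : Absorbent ℝ (newtonPolyhedron f) :=
    absorbent_nhds_zero (mem_interior_iff_mem_nhds.1 hconv)
  obtain ⟨c, hc0, hct, x, hx, hcx⟩ := exists_lt_of_gauge_lt habs ht
  obtain ⟨w, hw0, hw1, hwx⟩ := exists_weights_of_mem_convexHull expPt f.coeff.support (Set.Iic 1)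
    (convex_Iic 1) _ (by
      classical
      rintro _ (rfl | ⟨a, ha, rfl⟩)
      · exact ⟨0, by simp, by simp, by simp⟩
      · refine ⟨Pi.single a 1, fun b => ?_, ?_, ?_⟩
        · by_cases h : b = a
          · subst h; simp
          · simp [h]
        · rw [Finset.sum_eq_single_of_mem a (by exact_mod_cast ha)
            fun b _ hb => by simp [hb]]
          simp
        · rw [Finset.sum_eq_single_of_mem a (by exact_mod_cast ha)
            fun b _ hb => by simp [hb]]
          simp) hx
  obtain ⟨N, z, hNz, hN, hsum, hz⟩ := exists_int_relation f.coeff.support id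
    (fun a => c * w a) b 1 (by
      rw [one_smul, ← hcx, ← hwx]
      simp [Finset.smul_sum, mul_smul])
  refine ⟨N, z, hN one_pos, fun a ha => ?_, hNz, fun ht1 => hsum ?_⟩
  · rcases (mul_nonneg hc0.le (hw0 a)).lt_or_eq with h | h
    · exact ((hz a ha).1 h).le
    · exact ((hz a ha).2 h.symm).ge
  · rw [← Finset.mul_sum]
    rw [Set.mem_Iic] at hw1
    nlinarith

theorem map_le_zero_of_convenient {n : ℕ} {Λ : Type} [AddCommGroup Λ] [LinearOrder Λ]
    [IsOrderedAddMonoid Λ] {f : Laurent ℂ n} (hconv : IsConvenient f) (ℓ : (Fin n → ℤ) →+ Λ)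
    (hℓ : ∀ a ∈ f.coeff.support, ℓ a ≤ 0) (b : Fin n → ℤ) : ℓ b ≤ 0 := by
  obtain ⟨N, z, hN, hz, hb, -⟩ := exists_int_combination_of_gauge_lt hconv b (lt_add_one _)
  by_contra! h
  have h1 := zsmul_pos h hN
  rw [← map_zsmul, hb, map_sum] at h1
  refine absurd h1 (not_lt.2 (Finset.sum_nonpos fun a ha => ?_))
  rw [map_zsmul, ← neg_neg (ℓ a), smul_neg]
  exact neg_nonpos.2 (zsmul_nonneg (neg_nonneg.2 (hℓ a ha)) (hz a ha))

theorem map_lt_of_gauge_lt_one {n : ℕ} {Λ : Type} [AddCommGroup Λ] [LinearOrder Λ]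
    [IsOrderedAddMonoid Λ] {f : Laurent ℂ n} (hconv : IsConvenient f) (ℓ : (Fin n → ℤ) →+ Λ)
    {M : Λ} (hM : 0 < M) (hℓ : ∀ a ∈ f.coeff.support, ℓ a ≤ M) {b : Fin n → ℤ}
    (hb : gauge (newtonPolyhedron f) (expPt b) < 1) : ℓ b < M := by
  obtain ⟨N, z, hN, hz, hNb, hsum⟩ := exists_int_combination_of_gauge_lt hconv b hb
  by_contra! h
  have h1 : N • M ≤ N • ℓ b := zsmul_le_zsmul_right hN.le h
  have h2 : N • ℓ b ≤ (∑ a ∈ f.coeff.support, z a) • M := by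
    rw [← map_zsmul, hNb, map_sum, Finset.sum_smul]
    refine Finset.sum_le_sum fun a ha => ?_
    rw [map_zsmul]
    exact zsmul_le_zsmul_right (hz a ha) (hℓ a ha)
  have h3 := zsmul_lt_zsmul_left hM (hsum le_rfl)
  exact absurd (h1.trans h2) (not_le.2 h3)

/-! ### The Nullstellensatz on the torus; valuations of monomials -/

/-- The complex points of the ring of Laurent polynomials are the points of the torus. -/
theorem algHom_apply_eq_evalTorus {n : ℕ} (ψ : Laurent ℂ n →ₐ[ℂ] ℂ) :
    ∃ z : Fin n → ℂˣ, ∀ p, ψ p = evalTorus z p := by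
  let χ : Multiplicative (Fin n → ℤ) →* ℂˣ :=
    MonoidHom.toHomUnits ((ψ : Laurent ℂ n →* ℂ).comp (AddMonoidAlgebra.of ℂ (Fin n → ℤ)))
  refine ⟨fun i => χ (Multiplicative.ofAdd (Pi.single i 1)), fun p => ?_⟩
  have hχ : ∀ a : Fin n → ℤ, χ (Multiplicative.ofAdd a) =
      ∏ i, χ (Multiplicative.ofAdd (Pi.single i 1)) ^ a i := by
    intro a
    have ha : Multiplicative.ofAdd a =
        ∏ i, (Multiplicative.ofAdd (Pi.single i 1 : Fin n → ℤ)) ^ a i := by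
      apply Multiplicative.toAdd.injective
      rw [toAdd_ofAdd, toAdd_prod]
      ext j
      simp [Finset.sum_apply, Pi.single_apply]
    conv_lhs => rw [ha]
    simp only [map_prod, map_zpow]
  induction p using AddMonoidAlgebra.induction_linear with
  | zero => simp [evalTorus]
  | add p q hp hq =>
    rw [map_add, hp, hq]
    simp only [evalTorus]
    rw [AddMonoidAlgebra.coeff_add, Finsupp.sum_add_index'] <;> intros <;> ring
  | single a c =>
    have h1 : (AddMonoidAlgebra.single a c : Laurent ℂ n) = c • AddMonoidAlgebra.single a 1 := by
      simp
    have h2 : ψ (AddMonoidAlgebra.single a 1) = χ (Multiplicative.ofAdd a) := rfl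
    rw [h1, map_smul, h2, hχ]
    simp [evalTorus]

/-- The Nullstellensatz for Laurent polynomials. -/
theorem ideal_eq_top_of_no_common_zero {n : ℕ} {ι : Type} (q : ι → Laurent ℂ n)
    (hq : ¬ ∃ z : Fin n → ℂˣ, ∀ i, evalTorus z (q i) = 0) : Ideal.span (Set.range q) = ⊤ := by
  by_contra hne
  obtain ⟨m, hm, hle⟩ := Ideal.exists_le_maximal _ hne
  let _ : Field (Laurent ℂ n ⧸ m) := Ideal.Quotient.field m
  have : Algebra.FiniteType ℂ (Laurent ℂ n ⧸ m) :=
    .of_surjective (Ideal.Quotient.mkₐ ℂ m) (Ideal.Quotient.mkₐ_surjective ℂ m)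
  have : Module.Finite ℂ (Laurent ℂ n ⧸ m) := finite_of_finite_type_of_isJacobsonRing _ _
  let e : (Laurent ℂ n ⧸ m) ≃ₐ[ℂ] ℂ := (AlgEquiv.ofBijective (Algebra.ofId ℂ (Laurent ℂ n ⧸ m))
    (IsAlgClosed.algebraMap_bijective_of_isIntegral (k := ℂ))).symm
  obtain ⟨z, hz⟩ := algHom_apply_eq_evalTorus (e.toAlgHom.comp (Ideal.Quotient.mkₐ ℂ m))
  refine hq ⟨z, fun i => ?_⟩
  have : Ideal.Quotient.mkₐ ℂ m (q i) = 0 :=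
    Ideal.Quotient.eq_zero_iff_mem.2 (hle (Ideal.subset_span ⟨i, rfl⟩))
  rw [← hz, AlgHom.comp_apply, this, map_zero]

section Valuation

variable {n : ℕ} {L : Type} [Field L] [Algebra (Laurent ℂ n) L]
  {Γ₀ : Type} [LinearOrderedCommGroupWithZero Γ₀] (v : Valuation L Γ₀)

/-- The image of the monomial `u^a` in an extension field `L` of the ring of Laurent polynomials. -/
def monomialIn (L : Type) [Field L] [Algebra (Laurent ℂ n) L] (a : Fin n → ℤ) : L :=
  algebraMap (Laurent ℂ n) L (AddMonoidAlgebra.single a 1)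

theorem monomialIn_add (a b : Fin n → ℤ) :
    monomialIn L (a + b) = monomialIn L a * monomialIn L b := by
  simp [monomialIn, ← map_mul, AddMonoidAlgebra.single_mul_single]

theorem algebraMap_eq_sum (p : Laurent ℂ n) : algebraMap (Laurent ℂ n) L p =
    ∑ a ∈ p.coeff.support,
      algebraMap (Laurent ℂ n) L (algebraMap ℂ (Laurent ℂ n) (p.coeff a)) * monomialIn L a := by
  conv_lhs => rw [← AddMonoidAlgebra.sum_coeff_single p]
  rw [Finsupp.sum, map_sum]
  refine Finset.sum_congr rfl fun a _ => ?_
  rw [monomialIn, ← map_mul]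
  simp [AddMonoidAlgebra.single_mul_single]

variable [FaithfulSMul (Laurent ℂ n) L]

theorem monomialIn_ne_zero (a : Fin n → ℤ) : monomialIn L a ≠ 0 := by
  intro h
  have := (FaithfulSMul.algebraMap_injective (Laurent ℂ n) L) (h.trans (map_zero _).symm)
  simp at this

/-- The value `v (u^a)` as a function of the exponent `a`, written additively. -/
def monomialWeight : (Fin n → ℤ) →+ Additive Γ₀ˣ where
  toFun a := Additive.ofMul (Units.mk0 (v (monomialIn L a))
    ((Valuation.ne_zero_iff v).2 (monomialIn_ne_zero a)))
  map_zero' := by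
    apply Additive.toMul.injective
    ext
    simp [monomialIn, ← AddMonoidAlgebra.one_def]
  map_add' a b := by
    apply Additive.toMul.injective
    ext
    simp [monomialIn_add]

theorem valuation_monomialIn (a : Fin n → ℤ) :
    v (monomialIn L a) = ((monomialWeight v a).toMul : Γ₀ˣ) := rfl

/-- The valuation `v` is trivial on `ℂ`; as `ℂ` is a field, it is enough that `v ≤ 1` on `ℂ`. -/
def TrivialOnConstants (v : Valuation L Γ₀) : Prop :=
  ∀ c : ℂ, v (algebraMap (Laurent ℂ n) L (algebraMap ℂ (Laurent ℂ n) c)) ≤ 1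

variable {v}

theorem valuation_le (hv : TrivialOnConstants (n := n) v) (p : Laurent ℂ n) (B : Additive Γ₀ˣ)
    (hB : ∀ a ∈ p.coeff.support, monomialWeight v a ≤ B) :
    v (algebraMap (Laurent ℂ n) L p) ≤ (B.toMul : Γ₀ˣ) := by
  rw [algebraMap_eq_sum]
  refine v.map_sum_le fun a ha => ?_
  rw [map_mul]
  refine (mul_le_mul' (hv _) le_rfl).trans ?_
  rw [one_mul, valuation_monomialIn]
  exact_mod_cast hB a ha

theorem valuation_lt (hv : TrivialOnConstants (n := n) v) (p : Laurent ℂ n) (B : Additive Γ₀ˣ)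
    (hB : ∀ a ∈ p.coeff.support, monomialWeight v a < B) :
    v (algebraMap (Laurent ℂ n) L p) < (B.toMul : Γ₀ˣ) := by
  rw [algebraMap_eq_sum]
  refine v.map_sum_lt (Units.ne_zero _) fun a ha => ?_
  rw [map_mul]
  refine (mul_le_mul' (hv _) le_rfl).trans_lt ?_
  rw [one_mul, valuation_monomialIn]
  exact_mod_cast hB a ha

end Valuation

section Weight

variable {n : ℕ} {Λ : Type} [AddCommGroup Λ] (ℓ : (Fin n → ℤ) →+ Λ)

open Classical in
/-- The projection to the span of the monomials of weight `lam`. -/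
def weightPart (lam : Λ) : Laurent ℂ n →ₗ[ℂ] Laurent ℂ n :=
  (Finsupp.lsum ℂ fun a : Fin n → ℤ =>
    if ℓ a = lam then AddMonoidAlgebra.lsingle a else 0) ∘ₗ
      (AddMonoidAlgebra.coeffLinearEquiv ℂ).toLinearMap

open Classical in
theorem weightPart_single (lam : Λ) (a : Fin n → ℤ) (c : ℂ) :
    weightPart ℓ lam (AddMonoidAlgebra.single a c) =
      if ℓ a = lam then AddMonoidAlgebra.single a c else 0 := by
  by_cases h : ℓ a = lam <;> simp [weightPart, h]

theorem support_weightPart (lam : Λ) (p : Laurent ℂ n) :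
    ∀ a ∈ (weightPart ℓ lam p).coeff.support, ℓ a = lam := by
  intro a ha
  by_contra hne
  refine Finsupp.mem_support_iff.1 ha ?_
  clear ha
  induction p using AddMonoidAlgebra.induction_linear with
  | zero => simp
  | add p q hp hq => rw [map_add, AddMonoidAlgebra.coeff_add, Finsupp.add_apply, hp, hq, add_zero]
  | single b c =>
    rw [weightPart_single]
    split_ifs with h
    · have : b ≠ a := by rintro rfl; exact hne h
      simp [this]
    · simp

theorem weightPart_mul (lam m : Λ) (p q : Laurent ℂ n) (hq : ∀ a ∈ q.coeff.support, ℓ a = m) :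
    weightPart ℓ (lam + m) (p * q) = weightPart ℓ lam p * q := by
  induction p using AddMonoidAlgebra.induction_linear with
  | zero => simp
  | add p p' hp hp' => rw [add_mul, map_add, hp, hp', map_add, add_mul]
  | single b c =>
    conv_lhs => rw [← AddMonoidAlgebra.sum_coeff_single q]
    conv_rhs => rw [← AddMonoidAlgebra.sum_coeff_single q]
    rw [Finsupp.sum, Finset.mul_sum, Finset.mul_sum, map_sum]
    refine Finset.sum_congr rfl fun a ha => ?_
    rw [AddMonoidAlgebra.single_mul_single, weightPart_single, weightPart_single, map_add,
      hq a ha]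
    by_cases h : ℓ b = lam <;> simp [h, AddMonoidAlgebra.single_mul_single]

end Weight

/-! ### Valuations and nondegeneracy -/

section

variable {n : ℕ}

theorem coeff_euler (i : Fin n) (p : Laurent ℂ n) (a : Fin n → ℤ) :
    (euler ℂ i p).coeff a = a i * p.coeff a := by
  induction p using AddMonoidAlgebra.induction_linear with
  | zero => simp
  | add p q hp hq => simp [hp, hq, mul_add]
  | single b c =>
    rw [euler_single]
    by_cases h : b = a
    · subst h; simp
    · simp [h]

theorem support_euler_subset (i : Fin n) (p : Laurent ℂ n) :
    (euler ℂ i p).coeff.support ⊆ p.coeff.support := by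
  intro a ha
  rw [Finsupp.mem_support_iff, coeff_euler] at ha
  exact Finsupp.mem_support_iff.2 (right_ne_zero_of_mul ha)

variable {L : Type} [Field L] [Algebra (Laurent ℂ n) L] [FaithfulSMul (Laurent ℂ n) L]
  {Γ₀ : Type} [LinearOrderedCommGroupWithZero Γ₀] {v : Valuation L Γ₀}

/-- The place where nondegeneracy enters: if some monomial of `f` has value greater than `1`, then the
largest value of a monomial of `f` is attained by some `u_i ∂f/∂u_i`. Otherwise the
`u_i ∂f_Δ/∂u_i`, with `Δ` the face of maximal value, would all have smaller value too, although they
generate the unit ideal. -/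
theorem exists_le_valuation_euler {f : Laurent ℂ n} (hnd : IsNondegenerate f)
    (hv : TrivialOnConstants (n := n) v) (m : Fin n → ℤ) (hm : m ∈ f.coeff.support)
    (hpos : 0 < monomialWeight v m)
    (hmax : ∀ a ∈ f.coeff.support, monomialWeight v a ≤ monomialWeight v m) :
    ∃ i, v (monomialIn L m) ≤ v (algebraMap (Laurent ℂ n) L (euler ℂ i f)) := by
  by_contra! hlt
  obtain ⟨Δ, hΔ, hne, h0, hmem⟩ := exists_exposed_face f (monomialWeight v) m hm hpos hmax
  have htop := ideal_eq_top_of_no_common_zero _ (hnd Δ hΔ hne h0)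
  have hface : ∀ a, (facePart f Δ).coeff a ≠ 0 → f.coeff a ≠ 0 ∧ expPt a ∈ Δ := by
    intro a ha
    by_cases h : expPt a ∈ Δ
    · simp only [facePart, Finsupp.filter_apply, h, if_true] at ha
      exact ⟨ha, h⟩
    · simp [facePart, h] at ha
  have hweight : ∀ i, ∀ a ∈ (euler ℂ i (facePart f Δ)).coeff.support,
      monomialWeight v a = monomialWeight v m := by
    intro i a ha
    obtain ⟨h1, h2⟩ := hface a (Finsupp.mem_support_iff.1 (support_euler_subset i _ ha))
    exact (hmem a (Finsupp.mem_support_iff.2 h1)).1 h2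
  have hsmall : ∀ i, v (algebraMap (Laurent ℂ n) L (euler ℂ i (facePart f Δ))) <
      v (monomialIn L m) := by
    intro i
    have h1 : euler ℂ i (facePart f Δ) = euler ℂ i f - euler ℂ i (f - facePart f Δ) := by
      rw [map_sub]; ring
    rw [h1, map_sub]
    refine (v.map_sub _ _).trans_lt (max_lt (hlt i)
      (valuation_lt hv _ (monomialWeight v m) fun a ha => ?_))
    have ha' := Finsupp.mem_support_iff.1 (support_euler_subset i _ ha)
    have hΔ' : expPt a ∉ Δ := by
      intro h
      simp [facePart, h] at ha'
    have hf : a ∈ f.coeff.support := by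
      rw [Finsupp.mem_support_iff]
      intro h
      simp [facePart, h, hΔ'] at ha'
    exact lt_of_le_of_ne (hmax a hf) fun h => hΔ' ((hmem a hf).2 h)
  obtain ⟨c, hc⟩ := Ideal.mem_span_range_iff_exists_fun.1 ((Ideal.eq_top_iff_one _).1 htop)
  -- In `∑ c i * u_i ∂f_Δ/∂u_i = 1` only the part of `c i` of weight opposite to that of `Δ` matters.
  have hone : ∑ i, weightPart (monomialWeight v) (-monomialWeight v m) (c i) *
      euler ℂ i (facePart f Δ) = 1 := by
    have h := congrArg (weightPart (monomialWeight v) (-monomialWeight v m + monomialWeight v m)) hc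
    rw [map_sum] at h
    rw [Finset.sum_congr rfl fun i _ => weightPart_mul _ _ _ _ _ (hweight i)] at h
    rw [h, neg_add_cancel, AddMonoidAlgebra.one_def, weightPart_single, map_zero, if_pos rfl]
  have h1 : v (algebraMap (Laurent ℂ n) L 1) < 1 := by
    rw [← hone, map_sum]
    refine v.map_sum_lt one_ne_zero fun i _ => ?_
    rw [map_mul, map_mul]
    have hci := valuation_le hv (weightPart (monomialWeight v) (-monomialWeight v m) (c i))
      (-monomialWeight v m) fun a ha => (support_weightPart _ _ _ a ha).le
    refine (mul_le_mul' hci le_rfl).trans_lt ?_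
    refine (mul_lt_mul_of_pos_left (hsmall i) (Units.zero_lt _)).trans_eq ?_
    rw [valuation_monomialIn, ← Units.val_mul, toMul_neg, inv_mul_cancel, Units.val_one]
  simp at h1

theorem valuation_le_one {f : Laurent ℂ n} (hconv : IsConvenient f) (hnd : IsNondegenerate f)
    (hv : TrivialOnConstants (n := n) v)
    (hy : ∀ i, v (algebraMap (Laurent ℂ n) L (euler ℂ i f)) ≤ 1) (p : Laurent ℂ n) :
    v (algebraMap (Laurent ℂ n) L p) ≤ 1 := by
  have hle : ∀ a ∈ f.coeff.support, monomialWeight v a ≤ 0 := by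
    by_contra! hex
    obtain ⟨a, ha, hpos⟩ := hex
    obtain ⟨m, hm, hmax⟩ := Finset.exists_max_image f.coeff.support (monomialWeight v) ⟨a, ha⟩
    have hpos' := hpos.trans_le (hmax a ha)
    obtain ⟨i, hi⟩ := exists_le_valuation_euler hnd hv m hm hpos' hmax
    refine absurd (hi.trans (hy i)) (not_le.2 ?_)
    rw [valuation_monomialIn]
    exact_mod_cast hpos'
  exact valuation_le hv p 0 fun a _ => map_le_zero_of_convenient hconv _ hle a

theorem exists_lt_valuation_euler {f h : Laurent ℂ n} (hconv : IsConvenient f)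
    (hnd : IsNondegenerate f) (hv : TrivialOnConstants (n := n) v)
    (hh : ∀ a ∈ h.coeff.support, gauge (newtonPolyhedron f) (expPt a) < 1)
    (h1 : 1 < v (algebraMap (Laurent ℂ n) L h)) :
    ∃ i, v (algebraMap (Laurent ℂ n) L h) < v (algebraMap (Laurent ℂ n) L (euler ℂ i f)) := by
  obtain ⟨a, ha, hpos⟩ : ∃ a ∈ f.coeff.support, 0 < monomialWeight v a := by
    by_contra! hle
    exact absurd h1 (not_lt.2
      (valuation_le hv h 0 fun a _ => map_le_zero_of_convenient hconv _ hle a))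
  obtain ⟨m, hm, hmax⟩ := Finset.exists_max_image f.coeff.support (monomialWeight v) ⟨a, ha⟩
  have hpos' := hpos.trans_le (hmax a ha)
  obtain ⟨i, hi⟩ := exists_le_valuation_euler hnd hv m hm hpos' hmax
  exact ⟨i, (valuation_lt hv h _ fun b hb =>
    map_lt_of_gauge_lt_one hconv _ hpos' hmax (hh b hb)).trans_le hi⟩

end

/-! ### Integrality over the logarithmic derivatives -/

section

variable {n : ℕ}

theorem coeff_aeval_variables (p : MvPolynomial (Fin n) ℂ) (m : Fin n →₀ ℕ) :
    (aeval (fun i => (AddMonoidAlgebra.single (Pi.single i 1) 1 : Laurent ℂ n)) p).coeff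
      (fun i => (m i : ℤ)) = coeff m p := by
  classical
  induction p using MvPolynomial.induction_on' with
  | monomial k c =>
    have h1 : ∏ i, (AddMonoidAlgebra.single (Pi.single i 1) 1 : Laurent ℂ n) ^ k i =
        AddMonoidAlgebra.single (fun i => (k i : ℤ)) 1 := by
      simp only [AddMonoidAlgebra.single_pow, one_pow]
      have := map_prod (AddMonoidAlgebra.of ℂ (Fin n → ℤ))
        (fun i => Multiplicative.ofAdd (k i • (Pi.single i 1 : Fin n → ℤ))) Finset.univ
      simp only [AddMonoidAlgebra.of_apply, toAdd_ofAdd] at this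
      rw [← this]
      congr 1
      rw [toAdd_prod]
      ext j
      simp [Finset.sum_apply, Pi.single_apply]
    rw [aeval_monomial, Finsupp.prod_fintype _ _ (fun i => pow_zero _), h1, coeff_monomial,
      ← Algebra.smul_def, AddMonoidAlgebra.coeff_smul, Finsupp.smul_apply]
    by_cases h : k = m
    · subst h; simp
    · have : (fun i => (k i : ℤ)) ≠ fun i => (m i : ℤ) := fun h' => h (by
        ext i; exact_mod_cast congrFun h' i)
      simp [h, this]
  | add p q hp hq => simp [hp, hq]

/-- The variables `u_1, …, u_n` are algebraically independent. -/
theorem cardinalMk_fin_le_trdeg : (Cardinal.mk (Fin n)) ≤ Algebra.trdeg ℂ (Laurent ℂ n) := by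
  refine AlgebraicIndependent.cardinalMk_le_trdeg
    (x := fun i : Fin n => (AddMonoidAlgebra.single (Pi.single i 1) 1 : Laurent ℂ n)) ?_
  refine (injective_iff_map_eq_zero _).2 fun p hp => ?_
  ext m
  rw [← coeff_aeval_variables, hp]
  simp

variable {f : Laurent ℂ n}

/-- The ring of Laurent polynomials as an algebra over `ℂ[y_1, …, y_n]`, where `y_i` acts as
`u_i ∂f/∂u_i`. -/
abbrev eulerAlgebra (f : Laurent ℂ n) : Algebra (MvPolynomial (Fin n) ℂ) (Laurent ℂ n) :=
  (aeval fun i => euler ℂ i f).toRingHom.toAlgebra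

theorem trivialOnConstants_of_mem {L : Type} [Field L] [Algebra (Laurent ℂ n) L]
    (V : ValuationSubring L)
    (hV : ∀ c : ℂ, algebraMap (Laurent ℂ n) L (algebraMap ℂ (Laurent ℂ n) c) ∈ V) :
    TrivialOnConstants (n := n) V.valuation := fun c =>
  (ValuationSubring.valuation_le_one_iff _ _).2 (hV c)

/-- By the valuative criterion: a valuation that is at most `1` on all `u_i ∂f/∂u_i` is at most `1` on
all Laurent polynomials. -/
theorem isIntegral_eulerAlgebra (hconv : IsConvenient f) (hnd : IsNondegenerate f) :
    letI := eulerAlgebra f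
    Algebra.IsIntegral (MvPolynomial (Fin n) ℂ) (Laurent ℂ n) := by
  let _ := eulerAlgebra f
  let L := FractionRing (Laurent ℂ n)
  refine ⟨fun x => ?_⟩
  rw [← isIntegral_algebraMap_iff (IsFractionRing.injective (Laurent ℂ n) L)]
  by_contra hx
  have : IsIntegrallyClosedIn (integralClosure (MvPolynomial (Fin n) ℂ) L).toSubring L :=
    inferInstanceAs
      (IsIntegrallyClosedIn (integralClosure (MvPolynomial (Fin n) ℂ) L) L)
  obtain ⟨V, hV, hxV⟩ := Subring.exists_le_valuationSubring_of_isIntegrallyClosedIn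
    (R := (integralClosure (MvPolynomial (Fin n) ℂ) L).toSubring) hx
  have hP : ∀ q : MvPolynomial (Fin n) ℂ,
      algebraMap (Laurent ℂ n) L (aeval (fun i => euler ℂ i f) q) ∈ V := fun q =>
    hV (isIntegral_algebraMap (R := MvPolynomial (Fin n) ℂ) (A := L) (x := q))
  refine hxV ((ValuationSubring.valuation_le_one_iff _ _).1 (valuation_le_one hconv hnd
    (trivialOnConstants_of_mem V fun c => ?_) (fun i => ?_) x))
  · simpa only [aeval_C] using hP (C c)
  · rw [ValuationSubring.valuation_le_one_iff]
    simpa only [aeval_X] using hP (X i)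

/-- The `n` functions `u_i ∂f/∂u_i` generate a subring over which a ring of transcendence degree `n` is
integral. -/
theorem algebraicIndependent_euler (hconv : IsConvenient f) (hnd : IsNondegenerate f) :
    AlgebraicIndependent ℂ fun i => euler ℂ i f := by
  let _ := eulerAlgebra f
  have hint := isIntegral_eulerAlgebra hconv hnd
  let y : Fin n → Laurent ℂ n := fun i => euler ℂ i f
  have : Algebra.IsIntegral (Algebra.adjoin ℂ (Set.range y)) (Laurent ℂ n) := by
    refine ⟨fun x => ?_⟩
    refine (hint.isIntegral x).map_of_comp_eq
      (aeval (fun i => (⟨y i, Algebra.subset_adjoin ⟨i, rfl⟩⟩ :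
        Algebra.adjoin ℂ (Set.range y)))).toRingHom (RingHom.id _) ?_
    have : ((Algebra.adjoin ℂ (Set.range y)).val).comp
        (aeval (fun i => (⟨y i, Algebra.subset_adjoin ⟨i, rfl⟩⟩ :
        Algebra.adjoin ℂ (Set.range y)))) = aeval y := by
      refine algHom_ext fun i => ?_
      simp
    exact congrArg AlgHom.toRingHom this
  exact (Algebra.IsAlgebraic.isTranscendenceBasis_of_le_trdeg_of_finite ℂ y cardinalMk_fin_le_trdeg).1

/-- A Laurent polynomial `h` of Newton degree less than `1` is integral over `ℂ[u_i ∂f/∂u_i]` with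
coefficients of slope less than `1`. The relation is a homogenized form of
`h ∈ ℂ[h⁻¹, u_i ∂f/∂u_i h⁻¹]`, that is, of `h⁻¹` being a unit of this ring. Otherwise a valuation
would be less than `1` at `h⁻¹` and at most `1` on the ring, so that `h` would dominate all
`u_i ∂f/∂u_i`. -/
theorem exists_pow_eq_aeval (hconv : IsConvenient f) (hnd : IsNondegenerate f)
    {h : Laurent ℂ n} (h0 : h ≠ 0)
    (hh : ∀ a ∈ h.coeff.support, gauge (newtonPolyhedron f) (expPt a) < 1) :
    ∃ (d : ℕ) (G : MvPolynomial (Option (Fin n)) ℂ), G.totalDegree ≤ d ∧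
      h ^ (d + 1) = aeval (fun i => i.elim h fun s => euler ℂ s f) G := by
  let L := FractionRing (Laurent ℂ n)
  let φ : Laurent ℂ n →ₐ[ℂ] L := IsScalarTower.toAlgHom ℂ (Laurent ℂ n) L
  have hφ : Function.Injective φ := IsFractionRing.injective (Laurent ℂ n) L
  have hH : φ h ≠ 0 := fun h' => h0 (hφ (h'.trans (map_zero φ).symm))
  let A := Algebra.adjoin ℂ (insert (φ h)⁻¹ (Set.range fun i => φ (euler ℂ i f) * (φ h)⁻¹))
  have hinv : (φ h)⁻¹ ∈ A := Algebra.subset_adjoin (Set.mem_insert _ _)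
  have hmem : φ h ∈ A := by
    let I : Ideal A.toSubring := Ideal.span {⟨(φ h)⁻¹, hinv⟩}
    by_cases hI : I = ⊤
    · obtain ⟨a, ha⟩ := Ideal.mem_span_singleton'.1 ((Ideal.eq_top_iff_one I).1 hI)
      have ha' : (a : L) * (φ h)⁻¹ = 1 := congrArg Subtype.val ha
      have : φ h = a := by
        rw [← div_eq_mul_inv, div_eq_one_iff_eq hH] at ha'
        exact ha'.symm
      rw [this]; exact a.2
    · exfalso
      obtain ⟨V, hAV, hIV⟩ := Ideal.image_subset_nonunits_valuationSubring I hI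
      have h1 : V.valuation (φ h)⁻¹ < 1 :=
        (ValuationSubring.mem_nonunits_iff V).1 (hIV ⟨_, Ideal.mem_span_singleton_self _, rfl⟩)
      have h2 : 1 < V.valuation (φ h) := by
        rwa [map_inv₀, inv_lt_one₀ (by simpa [zero_lt_iff] using hH)] at h1
      obtain ⟨i, hi⟩ := exists_lt_valuation_euler hconv hnd
        (trivialOnConstants_of_mem V fun c => hAV (by
          have := A.algebraMap_mem c
          rwa [IsScalarTower.algebraMap_apply ℂ (Laurent ℂ n) L] at this)) hh h2
      have h3 : V.valuation (φ (euler ℂ i f) * (φ h)⁻¹) ≤ 1 :=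
        (ValuationSubring.valuation_le_one_iff _ _).2
          (hAV (Algebra.subset_adjoin (Set.mem_insert_of_mem _ ⟨i, rfl⟩)))
      rw [map_mul, map_inv₀, mul_inv_le_iff₀ (zero_lt_one.trans h2), one_mul] at h3
      exact absurd hi (not_lt.2 h3)
  let e : Option (Fin n) → Laurent ℂ n := fun i => i.elim h fun s => euler ℂ s f
  have key : ∀ x ∈ A, ∃ (d : ℕ) (G : MvPolynomial (Option (Fin n)) ℂ), G.totalDegree ≤ d ∧
      φ h ^ d * x = φ (aeval e G) := by
    intro x hx
    induction hx using Algebra.adjoin_induction with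
    | mem x hx =>
      rcases hx with rfl | ⟨i, rfl⟩
      · exact ⟨1, 1, by simp, by rw [pow_one, map_one, map_one, mul_inv_cancel₀ hH]⟩
      · refine ⟨1, X (some i), by simp, ?_⟩
        simp only [pow_one, aeval_X, e, Option.elim_some]
        rw [mul_left_comm, mul_inv_cancel₀ hH, mul_one]
    | algebraMap c => exact ⟨0, C c, by simp, by rw [aeval_C, φ.commutes, pow_zero, one_mul]⟩
    | add x y _ _ hx hy =>
      obtain ⟨d, G, hG, hx⟩ := hx
      obtain ⟨d', G', hG', hy⟩ := hy
      refine ⟨d + d', X none ^ d' * G + X none ^ d * G', ?_, ?_⟩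
      · refine (totalDegree_add _ _).trans (max_le ?_ ?_) <;>
        · refine (totalDegree_mul _ _).trans ?_
          rw [totalDegree_X_pow]
          omega
      · simp only [map_add, map_mul, map_pow, aeval_X, ← hx, ← hy, e, Option.elim_none]
        ring
    | mul x y _ _ hx hy =>
      obtain ⟨d, G, hG, hx⟩ := hx
      obtain ⟨d', G', hG', hy⟩ := hy
      refine ⟨d + d', G * G', (totalDegree_mul _ _).trans (add_le_add hG hG'), ?_⟩
      rw [map_mul, map_mul, ← hx, ← hy]
      ring
  obtain ⟨d, G, hG, hrel⟩ := key _ hmem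
  refine ⟨d, G, hG, hφ ?_⟩
  rw [map_pow, pow_succ, hrel]

/-- The ideal `(u_i ∂f/∂u_i)` contains no nonzero element of Newton degree less than `1`. -/
theorem eq_zero_of_mem_span_euler (hconv : IsConvenient f) (hnd : IsNondegenerate f)
    {h : Laurent ℂ n}
    (hh : ∀ a ∈ h.coeff.support, gauge (newtonPolyhedron f) (expPt a) < 1)
    (hJ : h ∈ Ideal.span (Set.range fun i => euler ℂ i f)) : h = 0 := by
  by_contra h0
  obtain ⟨d, G, hG, hrel⟩ := exists_pow_eq_aeval hconv hnd h0 hh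
  let _ := eulerAlgebra f
  have : IsScalarTower ℂ (MvPolynomial (Fin n) ℂ) (Laurent ℂ n) :=
    .of_algebraMap_eq fun c => ((aeval fun i => euler ℂ i f).commutes c).symm
  have hint := isIntegral_eulerAlgebra hconv hnd
  have : Algebra.FiniteType (MvPolynomial (Fin n) ℂ) (Laurent ℂ n) :=
    .of_restrictScalars_finiteType ℂ _ _
  have : Module.Finite (MvPolynomial (Fin n) ℂ) (Laurent ℂ n) := Algebra.IsIntegral.finite
  have : FaithfulSMul (MvPolynomial (Fin n) ℂ) (Laurent ℂ n) :=
    (faithfulSMul_iff_algebraMap_injective _ _).2 (algebraicIndependent_euler hconv hnd)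
  have hX : ∀ i, algebraMap (MvPolynomial (Fin n) ℂ) (Laurent ℂ n) (X i) = euler ℂ i f :=
    fun i => aeval_X _ i
  refine h0 (eq_zero_of_pow_eq_aeval (σ := Fin n) (k := ℂ) ?_ G hG ?_)
  · rw [idealOfVars, Ideal.map_span, ← Set.range_comp]
    simpa only [Function.comp_def, hX] using hJ
  · simpa only [hX] using hrel

end

/-! ### The fibre of the Higgs bundle at the origin -/

section

variable {n r : ℕ}

theorem jacobiIdeal_le_span_euler (f : Laurent ℂ n) :
    jacobiIdeal f ≤ Ideal.span (Set.range fun i => euler ℂ i f) := by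
  refine Ideal.span_le.2 ?_
  rintro _ ⟨i, rfl⟩
  exact Ideal.mul_mem_left _ _ (Ideal.subset_span ⟨i, rfl⟩)

theorem gauge_lt_one_of_isSubdiagram {f g : Laurent ℂ n} (hg : IsSubdiagram f g) :
    ∀ a ∈ g.coeff.support, gauge (newtonPolyhedron f) (expPt a) < 1 := by
  obtain ⟨α, hα, hg⟩ := hg
  have hα' : (α : ℝ) < 1 := by exact_mod_cast hα
  intro a ha
  by_contra! hlt
  refine Finsupp.mem_support_iff.1 ha ?_
  clear ha
  induction hg using Submodule.span_induction with
  | mem p hp =>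
    obtain ⟨b, hb, rfl⟩ := hp
    have : b ≠ a := by rintro rfl; linarith
    simp [this]
  | zero => simp
  | add p q _ _ hp hq => rw [AddMonoidAlgebra.coeff_add, Finsupp.add_apply, hp, hq, add_zero]
  | smul c p _ hp => rw [AddMonoidAlgebra.coeff_smul, Finsupp.smul_apply, hp, smul_zero]

theorem eq_zero_of_sum_smul_mem {f : Laurent ℂ n} (hconv : IsConvenient f)
    (hnd : IsNondegenerate f) {g : Fin r → Laurent ℂ n} (hg : ∀ j, IsSubdiagram f (g j))
    (hinj : IsInjectiveDeformation g) (c : Fin r → ℂ)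
    (hc : ∑ j, c j • g j ∈ Ideal.span (Set.range fun i => euler ℂ i f)) : c = 0 := by
  have h := eq_zero_of_mem_span_euler hconv hnd (h := ∑ j, c j • g j) (fun a ha => ?_) hc
  · exact funext (Fintype.linearIndependent_iff.1 hinj c h)
  · obtain ⟨j, hj⟩ : ∃ j, (g j).coeff a ≠ 0 := by
      by_contra! h0
      refine Finsupp.mem_support_iff.1 ha ?_
      simp [h0]
    exact gauge_lt_one_of_isSubdiagram (hg j) a (Finsupp.mem_support_iff.2 hj)

theorem linearIndependent_jacobiClass {f : Laurent ℂ n} (hconv : IsConvenient f)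
    (hnd : IsNondegenerate f) {g : Fin r → Laurent ℂ n} (hg : ∀ j, IsSubdiagram f (g j))
    (hinj : IsInjectiveDeformation g) : LinearIndependent ℂ fun j => jacobiClass f (g j) := by
  rw [Fintype.linearIndependent_iff]
  intro c hc j
  refine congrFun (eq_zero_of_sum_smul_mem hconv hnd hg hinj c
    (jacobiIdeal_le_span_euler f (Ideal.Quotient.eq_zero_iff_mem.1 ?_))) j
  rw [← hc, map_sum]
  rfl

theorem constLaurent_single (a : Fin n → ℤ) (c : ℂ) :
    constLaurent r (AddMonoidAlgebra.single a c) = AddMonoidAlgebra.single a (C c) := by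
  simp [constLaurent]

theorem constLaurent_smul (c : ℂ) (p : Laurent ℂ n) :
    constLaurent r (c • p) = c • constLaurent r p := by
  induction p using AddMonoidAlgebra.induction_linear with
  | zero => simp [constLaurent]
  | add p q hp hq =>
    simp only [constLaurent, smul_add, map_add] at *
    rw [hp, hq]
  | single a d =>
    simp only [AddMonoidAlgebra.smul_single, constLaurent_single, smul_eq_mul, C_mul, smul_eq_C_mul]

theorem constLaurent_euler (i : Fin n) (p : Laurent ℂ n) :
    constLaurent r (euler ℂ i p) = euler (Params r) i (constLaurent r p) := by
  induction p using AddMonoidAlgebra.induction_linear with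
  | zero => simp [constLaurent]
  | add p q hp hq =>
    simp only [constLaurent, map_add] at *
    rw [hp, hq]
  | single a d =>
    simp [constLaurent_single, euler_single]

/-- The specialization `x = 0`, `θ = 0` of Laurent polynomials with coefficients in `ℂ[x, θ]`. -/
def evalOrigin (n r : ℕ) : Laurent (Params r) n →+* Laurent ℂ n :=
  AddMonoidAlgebra.mapRingHom (Fin n → ℤ) (constantCoeff : Params r →+* ℂ)

theorem evalOrigin_single (a : Fin n → ℤ) (s : Params r) :
    evalOrigin n r (AddMonoidAlgebra.single a s) =
      AddMonoidAlgebra.single a (constantCoeff s) := by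
  simp [evalOrigin]

theorem evalOrigin_smul (s : Params r) (h : Laurent (Params r) n) :
    evalOrigin n r (s • h) = constantCoeff s • evalOrigin n r h := by
  induction h using AddMonoidAlgebra.induction_linear with
  | zero => simp
  | add p q hp hq => simp only [smul_add, map_add, hp, hq]
  | single a d => simp [evalOrigin_single]

theorem evalOrigin_euler (i : Fin n) (h : Laurent (Params r) n) :
    evalOrigin n r (euler (Params r) i h) = euler ℂ i (evalOrigin n r h) := by
  induction h using AddMonoidAlgebra.induction_linear with
  | zero => simp
  | add p q hp hq => simp only [map_add, hp, hq]
  | single a d => simp [evalOrigin_single, euler_single]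

theorem evalOrigin_constLaurent (p : Laurent ℂ n) : evalOrigin n r (constLaurent r p) = p := by
  induction p using AddMonoidAlgebra.induction_linear with
  | zero => simp [constLaurent]
  | add p q hp hq =>
    simp only [constLaurent, map_add] at *
    rw [hp, hq]
  | single a d => simp [constLaurent_single, evalOrigin_single]

variable (f : Laurent ℂ n) (g : Fin r → Laurent ℂ n)

theorem evalOrigin_deformation : evalOrigin n r (deformation f g) = f := by
  simp [deformation, evalOrigin_constLaurent, evalOrigin_smul]

/-- The class in the fibre `E^o` of the form `h du/u`. -/
def fibreClass : Laurent (Params r) n →ₗ[Params r] FibreE f g :=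
  Submodule.mkQ _ ∘ₗ Submodule.mkQ _ ∘ₗ Submodule.mkQ _

theorem fibreClass_surjective : Function.Surjective (fibreClass f g) :=
  (Submodule.mkQ_surjective _).comp
    ((Submodule.mkQ_surjective _).comp (Submodule.mkQ_surjective _))

theorem fibreClass_one : fibreClass f g 1 = omegaFibre f g := rfl

theorem fibreClass_complex_smul (c : ℂ) (h : Laurent (Params r) n) :
    fibreClass f g (c • h) = c • fibreClass f g h :=
  ((fibreClass f g).restrictScalars ℂ).map_smul c h

theorem fibreClass_twistedDifferential (b : Fin n → Laurent (Params r) n) :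
    fibreClass f g (twistedDifferential f g b) = 0 := by
  have h : (LinearMap.range (twistedDifferential f g)).mkQ (twistedDifferential f g b) = 0 :=
    (Submodule.Quotient.mk_eq_zero _).2 ⟨b, rfl⟩
  simp only [fibreClass, LinearMap.comp_apply, h, map_zero]

theorem fibreClass_theta_smul (h : Laurent (Params r) n) :
    fibreClass f g (theta r • h) = 0 := by
  have h' : (Submodule.mkQ _ (theta r • (LinearMap.range (twistedDifferential f g)).mkQ h) :
      HiggsBundle f g) = 0 := mk_theta_smul _
  rw [fibreClass, LinearMap.comp_apply, LinearMap.comp_apply, map_smul, h', map_zero]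

theorem fibreClass_X_smul (j : Fin r) (h : Laurent (Params r) n) :
    fibreClass f g ((X (some j) : Params r) • h) = 0 := by
  rw [fibreClass, LinearMap.comp_apply, LinearMap.comp_apply, map_smul, map_smul]
  exact (Submodule.Quotient.mk_eq_zero _).2
    (Submodule.smul_mem_smul (Ideal.subset_span ⟨j, rfl⟩) trivial)

theorem fibreMap_Higgs_fibreClass (j : Fin r) (h : Laurent (Params r) n) :
    fibreMap (Higgs f g j) (fibreClass f g h) = -fibreClass f g (constLaurent r (g j) * h) := by
  have h1 : fibreMap (Higgs f g j) (fibreClass f g h) = fibreClass f g (formX g j h) := rfl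
  rw [h1, formX_apply, map_sub, fibreClass_theta_smul, zero_sub]

theorem HiggsFibre_single (j : Fin r) :
    HiggsFibre f g (Pi.single j 1) = fibreMap (Higgs f g j) := by
  rw [HiggsFibre, Finset.sum_eq_single_of_mem j (Finset.mem_univ j)
    fun i _ hi => by simp [hi]]
  simp

/-- The period map sends `ξ` to the class of `∑ ξ_j g_j`. -/
theorem HiggsFibre_omegaFibre (ξ : Fin r → ℂ) :
    HiggsFibre f g ξ (omegaFibre f g) =
      -fibreClass f g (constLaurent r (∑ j, ξ j • g j)) := by
  have h : constLaurent r (∑ j, ξ j • g j) = ∑ j, ξ j • constLaurent r (g j) := by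
    simp only [← constLaurent_smul]
    exact map_sum (AddMonoidAlgebra.mapRingHom (Fin n → ℤ) (algebraMap ℂ (Params r))) _ _
  rw [h, map_sum, HiggsFibre, LinearMap.sum_apply, ← Finset.sum_neg_distrib]
  refine Finset.sum_congr rfl fun j _ => ?_
  rw [LinearMap.smul_apply, ← fibreClass_one, fibreMap_Higgs_fibreClass, mul_one,
    fibreClass_complex_smul, smul_neg]

/-- Pulls membership in `I • ⊤` back along a surjection, to pass through the successive quotients that
define the fibre `E^o`. -/
theorem mem_of_map_mem_smul_top {R M M' : Type} [CommRing R] [AddCommGroup M] [Module R M]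
    [AddCommGroup M'] [Module R M'] {π : M →ₗ[R] M'} (hπ : Function.Surjective π) {I : Ideal R}
    {N : Submodule R M} (hI : ∀ s ∈ I, ∀ m, s • m ∈ N) (hker : LinearMap.ker π ≤ N) {x : M}
    (hx : π x ∈ (I • ⊤ : Submodule R M')) : x ∈ N := by
  rw [← LinearMap.range_eq_top.2 hπ, ← Submodule.map_top, ← Submodule.map_smul''] at hx
  obtain ⟨y, hy, hyx⟩ := hx
  have hyN : y ∈ N := Submodule.smul_le.2 (fun s hs m _ => hI s hs m) hy
  have hxy : x - y ∈ N := hker (by rw [LinearMap.mem_ker, map_sub, hyx, sub_self])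
  simpa using N.add_mem hxy hyN

/-- The Laurent polynomials over `ℂ[x, θ]` whose specialization at `x = 0`, `θ = 0` lies in the ideal
`(u_i ∂f/∂u_i)`; it contains the kernel of `fibreClass`. -/
def evalOriginComap (f : Laurent ℂ n) (r : ℕ) : Submodule (Params r) (Laurent (Params r) n) where
  carrier := {h | evalOrigin n r h ∈ Ideal.span (Set.range fun i => euler ℂ i f)}
  add_mem' {a b} ha hb := by
    rw [Set.mem_ofPred_eq, map_add]
    exact Ideal.add_mem _ ha hb
  zero_mem' := by
    rw [Set.mem_ofPred_eq, map_zero]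
    exact Ideal.zero_mem _
  smul_mem' s h hh := by
    rw [Set.mem_ofPred_eq, evalOrigin_smul]
    exact Submodule.smul_of_tower_mem _ _ hh

theorem mem_evalOriginComap {h : Laurent (Params r) n} : h ∈ evalOriginComap f r ↔
    evalOrigin n r h ∈ Ideal.span (Set.range fun i => euler ℂ i f) := Iff.rfl

theorem smul_mem_evalOriginComap {s : Params r} (hs : constantCoeff s = 0)
    (h : Laurent (Params r) n) : s • h ∈ evalOriginComap f r := by
  rw [mem_evalOriginComap, evalOrigin_smul, hs, zero_smul]
  exact Ideal.zero_mem _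

theorem range_twistedDifferential_le :
    LinearMap.range (twistedDifferential f g) ≤ evalOriginComap f r := by
  rintro _ ⟨b, rfl⟩
  rw [mem_evalOriginComap, twistedDifferential_apply, map_sum]
  refine Ideal.sum_mem _ fun i _ => ?_
  rw [map_sub, evalOrigin_smul, map_mul, evalOrigin_euler i (deformation f g),
    evalOrigin_deformation]
  refine Ideal.sub_mem _ ?_ (Ideal.mul_mem_left _ _ (Ideal.subset_span ⟨i, rfl⟩))
  simp [theta]

/-- With `fibreClass_eq_zero_of_mem`, this identifies `E^o` with the quotient by `(u_i ∂f/∂u_i)`. -/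
theorem mem_of_fibreClass_eq_zero {p : Laurent ℂ n}
    (hp : fibreClass f g (constLaurent r p) = 0) :
    p ∈ Ideal.span (Set.range fun i => euler ℂ i f) := by
  have hθ : ∀ s ∈ Ideal.span {theta r}, constantCoeff s = 0 := by
    intro s hs
    obtain ⟨t, rfl⟩ := Ideal.mem_span_singleton'.1 hs
    simp [theta]
  have hx : ∀ s ∈ originIdeal r, constantCoeff s = 0 := by
    have hle : originIdeal r ≤ RingHom.ker (constantCoeff : Params r →+* ℂ) := by
      refine Ideal.span_le.2 ?_
      rintro _ ⟨j, rfl⟩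
      simp
    exact fun s hs => hle hs
  let π₁ : Laurent (Params r) n →ₗ[Params r] Brieskorn f g := Submodule.mkQ _
  let π₂ : Brieskorn f g →ₗ[Params r] HiggsBundle f g := Submodule.mkQ _
  have hπ₁ : Function.Surjective π₁ := Submodule.mkQ_surjective _
  have hπ₂ : Function.Surjective π₂ := Submodule.mkQ_surjective _
  have hker₁ : LinearMap.ker π₁ ≤ evalOriginComap f r :=
    (Submodule.ker_mkQ _).trans_le (range_twistedDifferential_le f g)
  have hker₂ : LinearMap.ker (π₂ ∘ₗ π₁) ≤ evalOriginComap f r := fun y hy =>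
    mem_of_map_mem_smul_top hπ₁ (fun s hs => smul_mem_evalOriginComap f (hθ s hs)) hker₁
      ((Submodule.Quotient.mk_eq_zero _).1 hy)
  have h : constLaurent r p ∈ evalOriginComap f r :=
    mem_of_map_mem_smul_top (π := π₂ ∘ₗ π₁) (hπ₂.comp hπ₁)
      (fun s hs => smul_mem_evalOriginComap f (hx s hs)) hker₂
      ((Submodule.Quotient.mk_eq_zero _).1 hp)
  rw [← evalOrigin_constLaurent (r := r) p]
  exact h

theorem fibreClass_eq_zero_of_mem {p : Laurent ℂ n}
    (hp : p ∈ Ideal.span (Set.range fun i => euler ℂ i f)) :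
    fibreClass f g (constLaurent r p) = 0 := by
  obtain ⟨c, rfl⟩ := Ideal.mem_span_range_iff_exists_fun.1 hp
  have h := fibreClass_twistedDifferential f g fun i => constLaurent r (c i)
  rw [twistedDifferential_apply, map_sum] at h
  have h' : constLaurent r (∑ i, c i * euler ℂ i f) =
      ∑ i, constLaurent r (c i) * euler (Params r) i (constLaurent r f) := by
    simp only [← constLaurent_euler]
    simp only [constLaurent, map_sum, map_mul]
  rw [h', map_sum, ← neg_eq_zero, ← h, ← Finset.sum_neg_distrib]
  refine Finset.sum_congr rfl fun i _ => ?_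
  rw [map_sub, fibreClass_theta_smul, zero_sub, deformation, map_add, mul_add, map_add, map_sum,
    Finset.mul_sum, map_sum, Finset.sum_eq_zero, add_zero]
  intro j _
  rw [Derivation.map_smul, mul_smul_comm, fibreClass_X_smul]

variable {f g} in
theorem satisfiesIC (hconv : IsConvenient f)
    (hnd : IsNondegenerate f) (hg : ∀ j, IsSubdiagram f (g j))
    (hinj : IsInjectiveDeformation g) : SatisfiesIC f g := by
  intro ξ ξ' h
  have h1 : fibreClass f g (constLaurent r (∑ j, (ξ - ξ') j • g j)) = 0 := by
    have h2 : constLaurent r (∑ j, (ξ - ξ') j • g j) =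
        constLaurent r (∑ j, ξ j • g j) - constLaurent r (∑ j, ξ' j • g j) := by
      simp only [Pi.sub_apply, sub_smul, Finset.sum_sub_distrib]
      exact map_sub (AddMonoidAlgebra.mapRingHom (Fin n → ℤ) (algebraMap ℂ (Params r))) _ _
    have h3 := neg_injective h
    rw [HiggsFibre_omegaFibre, HiggsFibre_omegaFibre] at h3
    rw [h2, map_sub, neg_injective h3, sub_self]
  exact sub_eq_zero.1 (eq_zero_of_sum_smul_mem hconv hnd hg hinj _
    (mem_of_fibreClass_eq_zero f g h1))

theorem fibreClass_mem (N : Submodule ℂ (FibreE f g))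
    (hN : ∀ p : Laurent ℂ n, fibreClass f g (constLaurent r p) ∈ N) (h : Laurent (Params r) n) :
    fibreClass f g h ∈ N := by
  induction h using AddMonoidAlgebra.induction_linear with
  | zero => rw [map_zero]; exact N.zero_mem
  | add p q hp hq => rw [map_add]; exact N.add_mem hp hq
  | single a s =>
    induction s using MvPolynomial.induction_on with
    | C c => rw [← constLaurent_single]; exact hN _
    | add s t hs ht =>
      have h : (AddMonoidAlgebra.single a (s + t) : Laurent (Params r) n) =
          AddMonoidAlgebra.single a s + AddMonoidAlgebra.single a t :=
        AddMonoidAlgebra.single_add a s t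
      rw [h, map_add]
      exact N.add_mem hs ht
    | mul_X s i hs =>
      have h : (AddMonoidAlgebra.single a (s * X i) : Laurent (Params r) n) =
          (X i : Params r) • AddMonoidAlgebra.single a s := by
        rw [AddMonoidAlgebra.smul_single, smul_eq_mul, mul_comm]
      rw [h]
      cases i with
      | none =>
        rw [show (X none : Params r) = theta r from rfl, fibreClass_theta_smul]
        exact N.zero_mem
      | some j => rw [fibreClass_X_smul]; exact N.zero_mem

variable {f g} in
theorem satisfiesGC (hsurj : IsSurjectiveDeformation f g) : SatisfiesGC f g := by
  rw [SatisfiesGC]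
  set G := Submonoid.closure (insert (R0Fibre f g) (Set.range (HiggsFibre f g)))
  set N := Submodule.span ℂ ((fun T : Module.End ℂ (FibreE f g) => T (omegaFibre f g)) ''
    (G : Set (Module.End ℂ (FibreE f g))))
  have hstable : ∀ T ∈ G, ∀ x ∈ N, T x ∈ N := by
    intro T hT x hx
    induction hx using Submodule.span_induction with
    | mem x hx =>
      obtain ⟨T', hT', rfl⟩ := hx
      exact Submodule.subset_span ⟨T * T', G.mul_mem hT hT', rfl⟩
    | zero => rw [map_zero]; exact N.zero_mem
    | add x y _ _ hx hy => rw [map_add]; exact N.add_mem hx hy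
    | smul c x _ hx => rw [map_smul]; exact N.smul_mem c hx
  have hpoly : ∀ p : MvPolynomial (Fin r) ℂ,
      fibreClass f g (constLaurent r (aeval g p)) ∈ N := by
    intro p
    induction p using MvPolynomial.induction_on with
    | C c =>
      have h : constLaurent r (aeval g (C c)) = c • (1 : Laurent (Params r) n) := by
        rw [aeval_C, Algebra.algebraMap_eq_smul_one, constLaurent_smul]
        simp [constLaurent]
      rw [h, fibreClass_complex_smul]
      exact N.smul_mem c (Submodule.subset_span ⟨1, G.one_mem, rfl⟩)
    | add p q hp hq =>
      have h : constLaurent r (aeval g (p + q)) =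
          constLaurent r (aeval g p) + constLaurent r (aeval g q) := by simp [constLaurent]
      rw [h, map_add]
      exact N.add_mem hp hq
    | mul_X p j hp =>
      have h : constLaurent r (aeval g (p * X j)) =
          constLaurent r (g j) * constLaurent r (aeval g p) := by
        simp [constLaurent, mul_comm]
      rw [h, ← neg_neg (fibreClass f g _), ← fibreMap_Higgs_fibreClass, ← HiggsFibre_single]
      exact N.neg_mem (hstable _
        (Submonoid.subset_closure (Set.mem_insert_of_mem _ ⟨_, rfl⟩)) _ hp)
  have hconst : ∀ p : Laurent ℂ n, fibreClass f g (constLaurent r p) ∈ N := by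
    intro p
    obtain ⟨q, hq⟩ := hsurj (jacobiClass f p)
    have h := fibreClass_eq_zero_of_mem f g
      (jacobiIdeal_le_span_euler f (Ideal.Quotient.eq.1 hq))
    have h' : constLaurent r (aeval g q - p) =
        constLaurent r (aeval g q) - constLaurent r p := by simp [constLaurent]
    rw [h', map_sub, sub_eq_zero] at h
    exact h ▸ hpoly q
  rw [eq_top_iff]
  rintro x -
  obtain ⟨h, rfl⟩ := fibreClass_surjective f g x
  exact fibreClass_mem f g N hconst h

end

end SubdiagramDeformation

end

open SubdiagramDeformation in
theorem proposition4p2p2 (n r : ℕ) (f : Laurent ℂ n) (hconv : IsConvenient f)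
    (hnd : IsNondegenerate f) (g : Fin r → Laurent ℂ n) (hg : ∀ j, IsSubdiagram f (g j)) :
    (IsInjectiveDeformation g →
      SatisfiesIC f g ∧ LinearIndependent ℂ (fun j => jacobiClass f (g j))) ∧
    (IsSurjectiveDeformation f g → SatisfiesGC f g) := by
  refine ⟨fun hinj => ⟨satisfiesIC hconv hnd hg hinj,
    linearIndependent_jacobiClass hconv hnd hg hinj⟩, fun hsurj => satisfiesGC hsurj⟩
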